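/- Let $a,b,c\ge 0$ be integers. A plane partition is a finite order ideal of $\mathbb{Z}_{+}^3$ (equivalently, a finite stack of unit cubes in the positive octant), and $N_1(a,b,c)$ is the number of plane partitions contained in the box $[0,a]\times[0,b]\times[0,c]$. Let $H(a,b,c)$ be the (possibly degenerate) hexagon with angles $2\pi/3$ whose opposite sides are equal, of lengths $a,b,c$, and let $T(a,b,c)$ be its tiling by unit equilateral triangles, each of which is either a $\nabla$ triangle or a $\Delta$ triangle. Let $Z(a,b,c)$ be the graph with vertex set $T(a,b,c)$ in which two triangles are joined when they share a side. Let $M(a,b,c)$ be the $0$-$1$ bipartite adjacency matrix of $Z(a,b,c)$, with rows indexed by the $\nabla$ triangles and columns by the $\Delta$ triangles. Put $H(n)=(n-1)!\,(n-2)!\cdots 1!\,0!$ for $n\ge 0$ (so $H(0)=1$). Then the following hold. 1. $Z(a,b,c)$ is bipartite with colour classes the $\nabla$ triangles and the $\Delta$ triangles, and these classes have the same size. For every bijection between the two classes, used to view $M(a,b,c)$ as a square matrix, $$|\mathrm{Det}(M(a,b,c))|=\mathrm{Per}(M(a,b,c))=N_1(a,b,c),$$ and this is also the number of perfect matchings of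 $Z(a,b,c)$. 2. $N_1(a,b,c)>0$, and if $c\ge 1$ then $$\frac{N_1(a+1,b+1,c-1)}{N_1(a,b,c)}=\binom{a+b+c}{c-1}\bigg/\binom{a+b}{a}.$$ 3. (MacMahon's formula) $$N_1(a,b,c)=\frac{H(a+b+c)\,H(a)\,H(b)\,H(c)}{H(a+b)\,H(a+c)\,H(b+c)}.$$ -/

import Mathlib

/-! ### Plane partitions in a box -/

/-- A plane partition: a finite set of unit cubes in the positive octant, each cube
`[x, x+1] × [y, y+1] × [z, z+1]` being named by its corner `(x, y, z) ∈ ℕ³`, which is an order ideal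
for the componentwise order. -/
def IsPlanePartition (π : Finset (ℕ × ℕ × ℕ)) : Prop :=
  IsLowerSet (π : Set (ℕ × ℕ × ℕ))

/-- The unit cubes of the box `[0, a] × [0, b] × [0, c]`. -/
def box (a b c : ℕ) : Finset (ℕ × ℕ × ℕ) :=
  Finset.range a ×ˢ Finset.range b ×ˢ Finset.range c

open Classical in
/-- `N₁(a, b, c)`: the number of plane partitions contained in the `a × b × c` box. -/
noncomputable def N1 (a b c : ℕ) : ℕ :=
  ((box a b c).powerset.filter IsPlanePartition).card

/-! ### The triangulated hexagon

The pair `(x, y) ∈ ℤ²` stands for the point `x + y·e^{iπ/3}` of the unit triangular lattice.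
In these coordinates the lattice directions at angles `0`, `π/3`, `2π/3` are `(1,0)`, `(0,1)`,
`(-1,1)`. -/

/-- Lattice points of the hexagon `H(a, b, c)` with corners, in counterclockwise order,
`(b, 0)`, `(b + c, 0)`, `(b + c, a)`, `(c, a + b)`, `(0, a + b)`, `(0, b)`;
successive sides have directions `0, π/3, 2π/3, π, 4π/3, 5π/3` and lengths `c, a, b, c, a, b`. -/
noncomputable def hexPoints (a b c : ℕ) : Finset (ℤ × ℤ) :=
  (Finset.Icc (0 : ℤ) (b + c) ×ˢ Finset.Icc (0 : ℤ) (a + b)).filter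
    (fun p => (b : ℤ) ≤ p.1 + p.2 ∧ p.1 + p.2 ≤ a + b + c)

/-- The corners of the unit `Δ` triangle with lower left corner `p`. -/
def upVerts (p : ℤ × ℤ) : Finset (ℤ × ℤ) :=
  {(p.1, p.2), (p.1 + 1, p.2), (p.1, p.2 + 1)}

/-- The corners of the unit `∇` triangle that shares the slanted right-hand side of the
`Δ` triangle with lower left corner `p`. -/
def downVerts (p : ℤ × ℤ) : Finset (ℤ × ℤ) :=
  {(p.1 + 1, p.2), (p.1, p.2 + 1), (p.1 + 1, p.2 + 1)}

/-- The `Δ` triangles of `T(a, b, c)` (see `mem_upTriangles`). -/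
noncomputable def upTriangles (a b c : ℕ) : Finset (ℤ × ℤ) :=
  (Finset.Icc (0 : ℤ) (b + c) ×ˢ Finset.Icc (0 : ℤ) (a + b)).filter
    (fun p => upVerts p ⊆ hexPoints a b c)

/-- The `∇` triangles of `T(a, b, c)` (see `mem_downTriangles`). -/
noncomputable def downTriangles (a b c : ℕ) : Finset (ℤ × ℤ) :=
  (Finset.Icc (0 : ℤ) (b + c) ×ˢ Finset.Icc (0 : ℤ) (a + b)).filter
    (fun p => downVerts p ⊆ hexPoints a b c)

theorem mem_upTriangles {a b c : ℕ} {p : ℤ × ℤ} :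
    p ∈ upTriangles a b c ↔ upVerts p ⊆ hexPoints a b c := by
  simp only [upTriangles, Finset.mem_filter, Finset.mem_product, Finset.mem_Icc, upVerts,
    hexPoints, Finset.insert_subset_iff, Finset.singleton_subset_iff]
  constructor
  · exact fun h => h.2
  · intro h
    exact ⟨h.1.1, h⟩

theorem mem_downTriangles {a b c : ℕ} {p : ℤ × ℤ} :
    p ∈ downTriangles a b c ↔ downVerts p ⊆ hexPoints a b c := by
  simp only [downTriangles, Finset.mem_filter, Finset.mem_product, Finset.mem_Icc, downVerts,
    hexPoints, Finset.insert_subset_iff, Finset.singleton_subset_iff]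
  constructor
  · exact fun h => h.2
  · intro h
    refine ⟨?_, h⟩
    omega

/-- The type of `Δ` triangles of `T(a, b, c)`. -/
abbrev UpTri (a b c : ℕ) : Type := {p : ℤ × ℤ // p ∈ upTriangles a b c}

/-- The type of `∇` triangles of `T(a, b, c)`. -/
abbrev DownTri (a b c : ℕ) : Type := {p : ℤ × ℤ // p ∈ downTriangles a b c}

/-- The corners of a triangle of `T(a, b, c)`; `Sum.inl` holds the `∇` triangles and `Sum.inr` the
`Δ` triangles. -/
def triVerts {a b c : ℕ} : DownTri a b c ⊕ UpTri a b c → Finset (ℤ × ℤ)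
  | Sum.inl p => downVerts p.1
  | Sum.inr p => upVerts p.1

/-- The graph `Z(a, b, c)`: its vertices are the triangles of `T(a, b, c)`, and two distinct
triangles are joined when they have a common side, that is, two common corners. -/
def Z (a b c : ℕ) : SimpleGraph (DownTri a b c ⊕ UpTri a b c) where
  Adj s t := s ≠ t ∧ (triVerts s ∩ triVerts t).card = 2
  symm := ⟨fun s t h => ⟨h.1.symm, by rw [Finset.inter_comm]; exact h.2⟩⟩
  loopless := ⟨fun s h => h.1 rfl⟩

open Classical in
/-- The bipartite adjacency matrix `M(a, b, c)` of `Z(a, b, c)`: rows are indexed by the `∇`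
triangles and columns by the `Δ` triangles. -/
noncomputable def M (a b c : ℕ) : Matrix (DownTri a b c) (UpTri a b c) ℤ :=
  fun d u => if (Z a b c).Adj (Sum.inl d) (Sum.inr u) then 1 else 0

/-! ### The hyperfactorial -/

/-- `H(n) = (n-1)! (n-2)! ⋯ 1! 0!`. -/
def H (n : ℕ) : ℕ := ∏ i ∈ Finset.range n, i.factorial

/-! Two encodings of a plane partition carry the proof.

Enumeration. The heights along the diagonals of the base rectangle interlace. Made strict, they form
a triangular array whose last row is `0, …, a-1, a+c, …, a+b+c-1`. Such arrays with last row `x` are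
counted by the determinant of the binomials `(x i).choose j` (`gtCount_eq_det`): summing over the
row above is multilinear, and the hockey-stick identity sums each entry. Up to `H n` this
determinant is a Vandermonde product (`gtCount_mul_H`), which evaluates to MacMahon's formula.
Positivity and the ratio follow from the formula.

Matchings. Seen along `(1,1,1)`, a stack of cubes is a lozenge tiling of the hexagon, that is, a
perfect matching of `Z`. The passage goes through integer height functions: a stack gives the height
at which its surface meets each line of sight, and a tiling gives its heights by summing edge
crossings. Hence there are `N1` tilings (`card_tiling`), and this is the permanent.

Sign. Removing a maximal cube lowers the height at one point, which changes the matching by a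
3-cycle, an even permutation (`IsHeight.exists_perm_of_flip`). Every stack shrinks to the empty one
in this way, so all nonzero terms of the determinant have the same sign. -/

/-! ### Counting interlacing arrays by a Vandermonde determinant. -/

/-- The number of triangular arrays of natural numbers with bottom row `x`, each row of which
interlaces with the next one. -/
def gtCount : (n : ℕ) → (Fin n → ℕ) → ℕ
  | 0, _ => 1
  | n + 1, x =>
    ∑ y ∈ Fintype.piFinset (fun i : Fin n => Finset.Ico (x i.castSucc) (x i.succ)), gtCount n y

theorem sum_Ico_choose_int {p q : ℕ} (h : p ≤ q) (j : ℕ) :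
    ∑ t ∈ Finset.Ico p q, (t.choose j : ℤ) = (q.choose (j + 1) : ℤ) - (p.choose (j + 1) : ℤ) := by
  induction q, h using Nat.le_induction with
  | base => simp
  | succ q h ih =>
    rw [Finset.sum_Ico_succ_top h, ih, Nat.choose_succ_succ]
    push_cast
    ring

/-- Subtracting from each row its predecessor turns the first column, all ones, into `(1, 0, …, 0)`;
expand along it. -/
theorem det_choose_succ {n : ℕ} (x : Fin (n + 1) → ℕ) :
    (Matrix.of fun i j : Fin (n + 1) => ((x i).choose j : ℤ)).det =
      (Matrix.of fun i j : Fin n =>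
        ((x i.succ).choose (j + 1) : ℤ) - ((x i.castSucc).choose (j + 1) : ℤ)).det := by
  have h := Matrix.det_eq_of_forall_row_eq_smul_add_pred
    (A := Matrix.of fun i j : Fin (n + 1) => ((x i).choose j : ℤ))
    (B := Matrix.of fun i j : Fin (n + 1) => Fin.cases ((x 0).choose j : ℤ)
      (fun i : Fin n => ((x i.succ).choose j : ℤ) - ((x i.castSucc).choose j : ℤ)) i)
    (fun _ => 1) (fun j => by simp) (fun i j => by simp)
  rw [h, Matrix.det_succ_column_zero, Fin.sum_univ_succ]
  simp [Matrix.submatrix]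

theorem gtCount_eq_det {n : ℕ} (x : Fin n → ℕ) (hx : Monotone x) :
    (gtCount n x : ℤ) = (Matrix.of fun i j : Fin n => ((x i).choose j : ℤ)).det := by
  induction n with
  | zero => simp [gtCount]
  | succ n ih =>
    -- Multilinearity in the rows: the determinant of summed rows is the sum, over all choices of
    -- `y`, of the determinants for `y`.
    have h := (Matrix.detRowAlternating (n := Fin n) (R := ℤ)).toMultilinearMap.map_sum_finset
      (fun (_ : Fin n) (t : ℕ) => (fun j : Fin n => (t.choose j : ℤ)))
      (fun i : Fin n => Finset.Ico (x i.castSucc) (x i.succ))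
    rw [det_choose_succ, gtCount, Nat.cast_sum]
    trans (Matrix.detRowAlternating (n := Fin n) (R := ℤ)).toMultilinearMap
      (fun i => ∑ t ∈ Finset.Ico (x i.castSucc) (x i.succ), fun j : Fin n => (t.choose j : ℤ))
    · rw [h]
      refine Finset.sum_congr rfl fun y hy => ?_
      rw [ih y]
      · rfl
      -- The intervals that hold successive entries of `y` follow one another, so `y` is again
      -- monotone.
      · rw [Fintype.mem_piFinset] at hy
        intro i j hij
        rcases hij.eq_or_lt with rfl | hij
        · exact le_rfl
        · have h1 := Finset.mem_Ico.1 (hy i)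
          have h2 := Finset.mem_Ico.1 (hy j)
          have h3 : x i.succ ≤ x j.castSucc := hx (by
            rw [Fin.le_def]; simpa using hij)
          omega
    · change Matrix.det _ = _
      congr 1
      ext i j
      rw [Finset.sum_apply, sum_Ico_choose_int (hx (Fin.castSucc_lt_succ).le)]
      rfl

theorem prod_Ioi_eq_prod_range {R : Type*} [CommMonoid R] (n : ℕ) (f : ℕ → ℕ → R) :
    ∏ i : Fin n, ∏ j ∈ Finset.Ioi i, f i j =
      ∏ j ∈ Finset.range n, ∏ i ∈ Finset.range j, f i j := by
  have h1 : ∀ i : Fin n, ∏ j ∈ Finset.Ioi i, f i j =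
      ∏ j : Fin n, if (i : ℕ) < j then f i j else 1 := fun i => by
    rw [← Finset.prod_filter]
    refine Finset.prod_congr ?_ fun _ _ => rfl
    ext j
    simp
  simp_rw [h1]
  rw [Finset.prod_comm, ← Fin.prod_univ_eq_prod_range]
  refine Finset.prod_congr rfl fun j _ => ?_
  rw [Fin.prod_univ_eq_prod_range (fun i => if i < (j : ℕ) then f i j else 1) n,
    ← Finset.prod_filter]
  refine Finset.prod_congr ?_ fun _ _ => rfl
  ext i
  simp only [Finset.mem_filter, Finset.mem_range]
  omega

theorem H_succ (n : ℕ) : H (n + 1) = H n * n.factorial := by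
  rw [H, Finset.prod_range_succ, ← H]

theorem H_pos (n : ℕ) : 0 < H n := Finset.prod_pos fun i _ => i.factorial_pos

/-- Multiplying column `j` by `j!` turns binomials into falling factorials, which are monic of
degree `j`, so the determinant becomes that of Vandermonde. -/
theorem gtCount_mul_H {n : ℕ} (x : ℕ → ℕ) (hx : Monotone x) :
    (gtCount n (fun i => x i) : ℤ) * H n =
      ∏ j ∈ Finset.range n, ∏ i ∈ Finset.range j, ((x j : ℤ) - x i) := by
  rw [← prod_Ioi_eq_prod_range n (fun i j => ((x j : ℤ) - x i)),
    ← Matrix.det_vandermonde (fun i : Fin n => (x i : ℤ)),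
    Matrix.det_eval_matrixOfPolynomials_eq_det_vandermonde (fun i : Fin n => (x i : ℤ))
      (fun i => descPochhammer ℤ i) (fun i => descPochhammer_natDegree ℤ i)
      (fun i => monic_descPochhammer ℤ i),
    gtCount_eq_det _ (fun i j h => hx h), mul_comm, H,
    ← Fin.prod_univ_eq_prod_range, Nat.cast_prod]
  rw [← Matrix.det_mul_row]
  congr 1
  ext i j
  simp only [Matrix.of_apply, descPochhammer_eval_eq_descFactorial,
    Nat.descFactorial_eq_factorial_mul_choose]
  push_cast
  ring

/-- The last row of the triangular arrays that encode plane partitions in a box. -/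
def jumpRow (a c i : ℕ) : ℕ := if i < a then i else i + c

theorem monotone_jumpRow (a c : ℕ) : Monotone (jumpRow a c) := by
  intro i j h
  unfold jumpRow
  split_ifs <;> omega

theorem prod_range_sub_eq_factorial (n : ℕ) :
    ∏ i ∈ Finset.range n, ((n : ℤ) - i) = n.factorial := by
  rw [← Finset.prod_range_reflect, ← Finset.prod_range_add_one_eq_factorial, Nat.cast_prod]
  refine Finset.prod_congr rfl fun i hi => ?_
  rw [Finset.mem_range] at hi
  push_cast [Nat.sub_sub, Nat.cast_sub (show 1 + i ≤ n by omega)]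
  ring

theorem prod_range_sub_mul_factorial (a m : ℕ) :
    (∏ i ∈ Finset.range a, (((a + m : ℕ) : ℤ) - i)) * m.factorial = (a + m).factorial := by
  rw [← prod_range_sub_eq_factorial (a + m), Finset.prod_range_add,
    ← prod_range_sub_eq_factorial m]
  congr 1
  refine Finset.prod_congr rfl fun i _ => ?_
  push_cast
  ring

theorem prod_jumpRow (a b c : ℕ) :
    (∏ j ∈ Finset.range (a + b), ∏ i ∈ Finset.range j,
      ((jumpRow a c j : ℤ) - jumpRow a c i)) * (H (a + c) * H (b + c)) =
      H a * H b * H c * H (a + b + c) := by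
  induction b with
  | zero =>
    have : ∏ j ∈ Finset.range a, ∏ i ∈ Finset.range j,
        ((jumpRow a c j : ℤ) - jumpRow a c i) = H a := by
      rw [H, Nat.cast_prod]
      refine Finset.prod_congr rfl fun j hj => ?_
      rw [← prod_range_sub_eq_factorial]
      refine Finset.prod_congr rfl fun i hi => ?_
      rw [Finset.mem_range] at hi hj
      simp [jumpRow, hj, hi.trans hj]
    simp only [add_zero, zero_add, this]
    simp [H]
    ring
  | succ b ih =>
    -- The factors brought in by the new last entry: the differences with the entries before the
    -- jump give `(a+b+c)!/(b+c)!`, those after it give `b!`.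
    have h1 : ∏ i ∈ Finset.range (a + b), ((jumpRow a c (a + b) : ℤ) - jumpRow a c i) =
        (∏ i ∈ Finset.range a, (((a + (b + c) : ℕ) : ℤ) - i)) * b.factorial := by
      rw [Finset.prod_range_add, ← prod_range_sub_eq_factorial b]
      congr 1
      · refine Finset.prod_congr rfl fun i hi => ?_
        rw [Finset.mem_range] at hi
        simp [jumpRow, hi, add_assoc]
      · refine Finset.prod_congr rfl fun i hi => ?_
        simp [jumpRow]
    have h2 := prod_range_sub_mul_factorial a (b + c)
    rw [← add_assoc a b 1, Finset.prod_range_succ, h1, show b + 1 + c = b + c + 1 by ring,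
      show a + b + 1 + c = a + (b + c) + 1 by ring, H_succ (b + c), H_succ (a + (b + c)),
      H_succ b]
    rw [add_assoc a b c] at ih
    push_cast at ih h2 ⊢
    linear_combination (∏ i ∈ Finset.range a, ((a + (b + c) : ℤ) - i)) * b.factorial *
      (b + c).factorial * ih + H a * H b * H c * H (a + (b + c)) * b.factorial * h2

theorem gtCount_jumpRow (a b c : ℕ) :
    gtCount (a + b) (fun i => jumpRow a c i) * (H (a + b) * H (a + c) * H (b + c)) =
      H (a + b + c) * H a * H b * H c := by
  have h1 := gtCount_mul_H (n := a + b) _ (monotone_jumpRow a c)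
  have h2 := prod_jumpRow a b c
  zify
  rw [← h1] at h2
  linear_combination h2

/-! ### Plane partitions as triangular arrays. -/

/-- `T r i`, for `i < r ≤ n`, is a triangular array with interlacing rows whose last row is `x`. -/
structure IsGTPattern (n : ℕ) (x : Fin n → ℕ) (T : ℕ → ℕ → ℕ) : Prop where
  interlace : ∀ r i, r + 1 ≤ n → i < r → T (r + 1) i ≤ T r i ∧ T r i < T (r + 1) (i + 1)
  zero : ∀ r i, n < r ∨ r ≤ i → T r i = 0
  last : ∀ i : Fin n, T n i = x i

/-- Splitting off the last row but one of a triangular array. -/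
noncomputable def gtPatternSuccEquiv (n : ℕ) (x : Fin (n + 1) → ℕ) :
    {T // IsGTPattern (n + 1) x T} ≃
      Σ y : ↥(Fintype.piFinset (fun i : Fin n => Finset.Ico (x i.castSucc) (x i.succ))),
        {T // IsGTPattern n y.1 T} where
  toFun T := ⟨⟨fun i => T.1 n i, by
      rw [Fintype.mem_piFinset]
      intro i
      have h := T.2.interlace n i le_rfl i.2
      have h1 := T.2.last i.castSucc
      have h2 := T.2.last i.succ
      simp only [Fin.val_castSucc, Fin.val_succ] at h1 h2
      rw [Finset.mem_Ico, ← h1, ← h2]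
      exact h⟩,
    ⟨Function.update T.1 (n + 1) 0, by
      refine ⟨fun r i hr hi => ?_, fun r i h => ?_, fun i => ?_⟩
      · rw [Function.update_of_ne (by omega), Function.update_of_ne (by omega)]
        exact T.2.interlace r i (by omega) hi
      · by_cases hr : r = n + 1
        · subst hr
          simp
        · rw [Function.update_of_ne hr]
          exact T.2.zero r i (by omega)
      · rw [Function.update_of_ne (by omega)]⟩⟩
  invFun p := ⟨Function.update p.2.1 (n + 1) (fun i => if h : i < n + 1 then x ⟨i, h⟩ else 0), by
    obtain ⟨⟨y, hy⟩, T, hT⟩ := p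
    rw [Fintype.mem_piFinset] at hy
    refine ⟨fun r i hr hi => ?_, fun r i h => ?_, fun i => ?_⟩
    · have e : Function.update T (n + 1) (fun i => if h : i < n + 1 then x ⟨i, h⟩ else 0) r = T r :=
        Function.update_of_ne (by omega) _ _
      rw [e]
      by_cases hrn : r = n
      · subst hrn
        have h := Finset.mem_Ico.1 (hy ⟨i, hi⟩)
        have h1 := hT.last ⟨i, hi⟩
        simp only [Function.update_self]
        rw [dif_pos (by omega), dif_pos (by omega)]
        simp only at h1
        rw [h1]
        exact h
      · rw [Function.update_of_ne (by omega)]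
        exact hT.interlace r i (by omega) hi
    · by_cases hr : r = n + 1
      · subst hr
        simp only [Function.update_self]
        rw [dif_neg (by omega)]
      · rw [Function.update_of_ne hr]
        exact hT.zero r i (by omega)
    · simp only [Function.update_self]
      rw [dif_pos i.2]⟩
  left_inv T := by
    apply Subtype.ext
    funext r i
    by_cases hr : r = n + 1
    · subst hr
      simp only [Function.update_self]
      split_ifs with h
      · exact (T.2.last ⟨i, h⟩).symm
      · exact (T.2.zero _ _ (by omega)).symm
    · simp [Function.update_of_ne hr]
  right_inv p := by
    obtain ⟨⟨y, hy⟩, T, hT⟩ := p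
    have h1 : (fun i : Fin n => Function.update T (n + 1)
        (fun i => if h : i < n + 1 then x ⟨i, h⟩ else 0) n i) = y := by
      funext i
      rw [Function.update_of_ne (by omega), hT.last i]
    have h2 : Function.update (Function.update T (n + 1)
        (fun i => if h : i < n + 1 then x ⟨i, h⟩ else 0)) (n + 1) 0 = T := by
      rw [Function.update_idem, Function.update_eq_self_iff]
      funext i
      exact (hT.zero _ _ (by omega)).symm
    subst h1
    simp only [h2]

/-- Finiteness is part of the induction because `Nat.card` of a sigma type is the sum of the
cardinalities only for finite fibres. -/
theorem finite_and_card_gtPattern (n : ℕ) (x : Fin n → ℕ) :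
    Finite {T // IsGTPattern n x T} ∧ Nat.card {T // IsGTPattern n x T} = gtCount n x := by
  induction n with
  | zero =>
    have h : ∀ T, IsGTPattern 0 x T ↔ T = 0 := fun T => by
      constructor
      · intro h
        funext r i
        exact h.zero r i (by omega)
      · rintro rfl
        exact ⟨fun r i h => by omega, fun _ _ _ => rfl, fun i => i.elim0⟩
    simp only [h]
    exact ⟨inferInstance, by simp [gtCount]⟩
  | succ n ih =>
    have := fun y => (ih y).1
    refine ⟨Finite.of_equiv _ (gtPatternSuccEquiv n x).symm, ?_⟩
    rw [Nat.card_congr (gtPatternSuccEquiv n x), Nat.card_sigma, gtCount]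
    exact (Finset.sum_congr rfl fun y _ => (ih y.1).2).trans
      (Finset.sum_coe_sort _ fun y => gtCount n y)

theorem IsGTPattern.le_down {n : ℕ} {x : Fin n → ℕ} {T : ℕ → ℕ → ℕ} (hT : IsGTPattern n x T)
    {r i k : ℕ} (hi : i < r) (hr : r + k ≤ n) : T (r + k) i ≤ T r i := by
  induction k with
  | zero => exact le_rfl
  | succ k ih =>
    exact (hT.interlace (r + k) i (by omega) (by omega)).1.trans (ih (by omega))

/-- With `le_down`, this compares entries along the two directions of the base: down a column `y`
grows, along a diagonal `x` shrinks. Followed to the last row, the two bound every entry from below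
and above. -/
theorem IsGTPattern.le_diag {n : ℕ} {x : Fin n → ℕ} {T : ℕ → ℕ → ℕ} (hT : IsGTPattern n x T)
    {r i k : ℕ} (hi : i < r) (hr : r + k ≤ n) : T r i + k ≤ T (r + k) (i + k) := by
  induction k with
  | zero => exact le_rfl
  | succ k ih =>
    have h1 := (hT.interlace (r + k) (i + k) (by omega) (by omega)).2
    have h2 := ih (by omega)
    simp only [← add_assoc]
    omega

/-- The number of cubes of `π` above the unit square with corner `(x, y)`, up to height `c`. -/
def columnHeight (c : ℕ) (π : Finset (ℕ × ℕ × ℕ)) (x y : ℕ) : ℕ :=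
  ((Finset.range c).filter fun z => (x, y, z) ∈ π).card

theorem mem_box {a b c x y z : ℕ} : (x, y, z) ∈ box a b c ↔ x < a ∧ y < b ∧ z < c := by
  simp [box]

/-- The type of plane partitions in the `a × b × c` box. -/
abbrev PP (a b c : ℕ) : Type := {π : Finset (ℕ × ℕ × ℕ) // π ⊆ box a b c ∧ IsPlanePartition π}

theorem card_PP (a b c : ℕ) : Nat.card (PP a b c) = N1 a b c := by
  classical
  rw [N1, ← Nat.card_eq_finsetCard]
  exact Nat.card_congr (Equiv.subtypeEquivRight fun π => by simp)

theorem IsPlanePartition.mem_of_le {π : Finset (ℕ × ℕ × ℕ)} (h : IsPlanePartition π)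
    {x y z x' y' z' : ℕ} (hx : x' ≤ x) (hy : y' ≤ y) (hz : z' ≤ z) (hm : (x, y, z) ∈ π) :
    (x', y', z') ∈ π :=
  h (show (x', y', z') ≤ (x, y, z) from ⟨hx, hy, hz⟩) hm

theorem columnHeight_le (c : ℕ) (π : Finset (ℕ × ℕ × ℕ)) (x y : ℕ) : columnHeight c π x y ≤ c :=
  (Finset.card_filter_le _ _).trans (Finset.card_range c).le

theorem columnHeight_mono {c : ℕ} {π : Finset (ℕ × ℕ × ℕ)} (h : IsPlanePartition π)
    {x y x' y' : ℕ} (hx : x' ≤ x) (hy : y' ≤ y) :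
    columnHeight c π x y ≤ columnHeight c π x' y' :=
  Finset.card_le_card fun z hz => by
    rw [Finset.mem_filter] at hz ⊢
    exact ⟨hz.1, h.mem_of_le hx hy le_rfl hz.2⟩

theorem columnHeight_eq_zero {a b c : ℕ} {π : Finset (ℕ × ℕ × ℕ)} (h : π ⊆ box a b c)
    {x y : ℕ} (hy : b ≤ y) : columnHeight c π x y = 0 := by
  rw [columnHeight, Finset.card_eq_zero, Finset.filter_eq_empty_iff]
  intro z _ hz
  have := mem_box.1 (h hz)
  omega

theorem card_filter_range_lt {c h : ℕ} (hh : h ≤ c) :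
    ((Finset.range c).filter fun z => z < h).card = h := by
  rw [show (Finset.range c).filter (fun z => z < h) = Finset.range h by
    ext z
    simp only [Finset.mem_filter, Finset.mem_range]
    omega, Finset.card_range]

theorem mem_iff_lt_columnHeight {a b c : ℕ} {π : Finset (ℕ × ℕ × ℕ)} (hb : π ⊆ box a b c)
    (h : IsPlanePartition π) {x y z : ℕ} : (x, y, z) ∈ π ↔ z < columnHeight c π x y := by
  constructor
  · intro hz
    have hsub : Finset.range (z + 1) ⊆ (Finset.range c).filter fun z => (x, y, z) ∈ π := by
      intro w hw
      have := mem_box.1 (hb hz)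
      rw [Finset.mem_range] at hw
      rw [Finset.mem_filter, Finset.mem_range]
      exact ⟨by omega, h.mem_of_le le_rfl le_rfl (by omega) hz⟩
    have := Finset.card_le_card hsub
    rw [Finset.card_range] at this
    exact this
  · intro hz
    by_contra hn
    have hsub : ((Finset.range c).filter fun z => (x, y, z) ∈ π) ⊆ Finset.range z := by
      intro w hw
      rw [Finset.mem_filter] at hw
      rw [Finset.mem_range]
      by_contra hw'
      exact hn (h.mem_of_le le_rfl le_rfl (by omega) hw.2)
    have := Finset.card_le_card hsub
    rw [Finset.card_range] at this
    exact absurd hz (by unfold columnHeight; omega)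

/-- The triangular array of a plane partition: row `r` lists the heights along the diagonal of
squares `(a - 1 - i, r - 1 - i)`, made strictly increasing by adding `i`. -/
def gtOfPP (a b c : ℕ) (π : Finset (ℕ × ℕ × ℕ)) (r i : ℕ) : ℕ :=
  if r ≤ a + b ∧ i < r then (if i < a then columnHeight c π (a - 1 - i) (r - 1 - i) else c) + i
  else 0

theorem isGTPattern_gtOfPP {a b c : ℕ} {π : Finset (ℕ × ℕ × ℕ)} (hb : π ⊆ box a b c)
    (h : IsPlanePartition π) :
    IsGTPattern (a + b) (fun i => jumpRow a c i) (gtOfPP a b c π) := by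
  refine ⟨fun r i hr hi => ?_, fun r i hr => ?_, fun i => ?_⟩
  · unfold gtOfPP
    rw [if_pos (show r + 1 ≤ a + b ∧ i < r + 1 by omega),
      if_pos (show r ≤ a + b ∧ i < r by omega),
      if_pos (show r + 1 ≤ a + b ∧ i + 1 < r + 1 by omega)]
    -- The lower neighbour in the array is one square further in `y`, the diagonal one is one square
    -- nearer in `x`. The added `i` makes the second inequality strict.
    have h1 : columnHeight c π (a - 1 - i) (r + 1 - 1 - i) ≤
      columnHeight c π (a - 1 - i) (r - 1 - i) := columnHeight_mono h le_rfl (by omega)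
    have h2 : columnHeight c π (a - 1 - i) (r - 1 - i) ≤
      columnHeight c π (a - 1 - (i + 1)) (r + 1 - 1 - (i + 1)) :=
      columnHeight_mono h (by omega) (by omega)
    have h3 := columnHeight_le c π (a - 1 - i) (r - 1 - i)
    split_ifs <;> omega
  · exact if_neg (by omega)
  · have hi := i.2
    unfold gtOfPP jumpRow
    rw [if_pos (by omega)]
    split_ifs with h1
    -- In the last row the squares with `i < a` lie beyond the side `y = b`, where the height is
    -- `0`.
    · rw [columnHeight_eq_zero hb (by omega), zero_add]
    · omega

/-- The plane partition of a triangular array. -/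
def ppOfGT (a b c : ℕ) (T : ℕ → ℕ → ℕ) : Finset (ℕ × ℕ × ℕ) :=
  (box a b c).filter fun v => v.2.2 + (a - 1 - v.1) < T (v.2.1 + a - v.1) (a - 1 - v.1)

theorem ppOfGT_subset (a b c : ℕ) (T : ℕ → ℕ → ℕ) : ppOfGT a b c T ⊆ box a b c :=
  Finset.filter_subset _ _

theorem mem_ppOfGT {a b c : ℕ} {T : ℕ → ℕ → ℕ} {x y z : ℕ} :
    (x, y, z) ∈ ppOfGT a b c T ↔
      (x < a ∧ y < b ∧ z < c) ∧ z + (a - 1 - x) < T (y + a - x) (a - 1 - x) := by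
  rw [ppOfGT, Finset.mem_filter, mem_box]

theorem isPlanePartition_ppOfGT {a b c : ℕ} {T : ℕ → ℕ → ℕ}
    (hT : IsGTPattern (a + b) (fun i => jumpRow a c i) T) :
    IsPlanePartition (ppOfGT a b c T) := by
  rintro ⟨x, y, z⟩ ⟨x', y', z'⟩ ⟨hx, hy, hz⟩ hm
  simp only at hx hy hz
  simp only [Finset.mem_coe, mem_ppOfGT] at hm ⊢
  obtain ⟨⟨h1, h2, h3⟩, h4⟩ := hm
  refine ⟨by omega, ?_⟩
  have h5 := hT.le_down (r := y' + a - x) (i := a - 1 - x) (k := y - y') (by omega) (by omega)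
  have h6 := hT.le_diag (r := y' + a - x) (i := a - 1 - x) (k := x - x') (by omega) (by omega)
  rw [show y' + a - x + (y - y') = y + a - x by omega] at h5
  rw [show y' + a - x + (x - x') = y' + a - x' by omega,
    show a - 1 - x + (x - x') = a - 1 - x' by omega] at h6
  omega

theorem gtOfPP_ppOfGT {a b c : ℕ} {T : ℕ → ℕ → ℕ}
    (hT : IsGTPattern (a + b) (fun i => jumpRow a c i) T) :
    gtOfPP a b c (ppOfGT a b c T) = T := by
  funext r i
  unfold gtOfPP
  split_ifs with h hi
  · have h1 := hT.le_down (r := r) (i := i) (k := a + b - r) h.2 (by omega)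
    have h2 := hT.le_diag (r := r) (i := i) (k := a + b - r) h.2 (by omega)
    rw [show r + (a + b - r) = a + b by omega] at h1 h2
    have h3 := hT.last ⟨i, by omega⟩
    have h4 := hT.last ⟨i + (a + b - r), by omega⟩
    simp only [jumpRow] at h3 h4
    rw [h3, if_pos hi] at h1
    rw [h4] at h2
    -- Inside the rectangle the diagonal reaches the last row after the jump, giving `T r i ≤ i +
    -- c`; beyond it, it arrives before the jump and forces `T r i = i`.
    by_cases hb : r - 1 - i < b
    · have h5 : T r i ≤ i + c := by
        split_ifs at h2 <;> omega
      have h6 : columnHeight c (ppOfGT a b c T) (a - 1 - i) (r - 1 - i) = T r i - i := by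
        rw [← card_filter_range_lt (show T r i - i ≤ c by omega), columnHeight]
        congr 1
        refine Finset.filter_congr fun z hz => ?_
        rw [Finset.mem_range] at hz
        rw [mem_ppOfGT, show a - 1 - (a - 1 - i) = i by omega,
          show r - 1 - i + a - (a - 1 - i) = r by omega]
        omega
      omega
    · rw [columnHeight_eq_zero (ppOfGT_subset a b c T) (by omega)]
      rw [if_pos (by omega)] at h2
      omega
  · have h1 := hT.le_down (r := r) (i := i) (k := a + b - r) h.2 (by omega)
    have h2 := hT.le_diag (r := r) (i := i) (k := a + b - r) h.2 (by omega)
    rw [show r + (a + b - r) = a + b by omega] at h1 h2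
    have h3 := hT.last ⟨i, by omega⟩
    have h4 := hT.last ⟨i + (a + b - r), by omega⟩
    simp only [jumpRow] at h3 h4
    rw [h3, if_neg hi] at h1
    rw [h4, if_neg (by omega)] at h2
    omega
  · exact (hT.zero r i (by omega)).symm

theorem ppOfGT_gtOfPP {a b c : ℕ} {π : Finset (ℕ × ℕ × ℕ)} (hb : π ⊆ box a b c)
    (h : IsPlanePartition π) : ppOfGT a b c (gtOfPP a b c π) = π := by
  ext ⟨x, y, z⟩
  rw [mem_ppOfGT]
  constructor
  · rintro ⟨⟨h1, h2, h3⟩, h4⟩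
    rw [gtOfPP, if_pos (by omega), if_pos (by omega), show a - 1 - (a - 1 - x) = x by omega,
      show y + a - x - 1 - (a - 1 - x) = y by omega] at h4
    rw [mem_iff_lt_columnHeight hb h]
    omega
  · intro hm
    have h1 := mem_box.1 (hb hm)
    refine ⟨h1, ?_⟩
    rw [mem_iff_lt_columnHeight hb h] at hm
    rw [gtOfPP, if_pos (by omega), if_pos (by omega), show a - 1 - (a - 1 - x) = x by omega,
      show y + a - x - 1 - (a - 1 - x) = y by omega]
    omega

theorem N1_eq_gtCount (a b c : ℕ) : N1 a b c = gtCount (a + b) (fun i => jumpRow a c i) := by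
  rw [← card_PP, ← (finite_and_card_gtPattern (a + b) _).2]
  exact Nat.card_congr
    { toFun := fun π => ⟨gtOfPP a b c π.1, isGTPattern_gtOfPP π.2.1 π.2.2⟩
      invFun := fun T => ⟨ppOfGT a b c T.1, ppOfGT_subset a b c T.1, isPlanePartition_ppOfGT T.2⟩
      left_inv := fun π => Subtype.ext (ppOfGT_gtOfPP π.2.1 π.2.2)
      right_inv := fun T => Subtype.ext (gtOfPP_ppOfGT T.2) }

/-! ### MacMahon's formula and the ratio. -/

theorem N1_mul_H (a b c : ℕ) :
    N1 a b c * (H (a + b) * H (a + c) * H (b + c)) = H (a + b + c) * H a * H b * H c := by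
  rw [N1_eq_gtCount, gtCount_jumpRow]

theorem N1_pos (a b c : ℕ) : 0 < N1 a b c := by
  have h : 0 < N1 a b c * (H (a + b) * H (a + c) * H (b + c)) := by
    rw [N1_mul_H]
    have := H_pos
    simp [this]
  exact Nat.pos_of_mul_pos_right h

theorem N1_eq_div (a b c : ℕ) : (N1 a b c : ℚ) =
    (H (a + b + c) * H a * H b * H c : ℚ) / (H (a + b) * H (a + c) * H (b + c) : ℚ) := by
  have h := fun n => (Nat.cast_pos (α := ℚ)).2 (H_pos n)
  rw [eq_div_iff (by have := h (a + b); have := h (a + c); have := h (b + c); positivity)]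
  exact_mod_cast N1_mul_H a b c

theorem N1_ratio (a b c : ℕ) (hc : 1 ≤ c) :
    (N1 (a + 1) (b + 1) (c - 1) : ℚ) / (N1 a b c : ℚ) =
      ((a + b + c).choose (c - 1) : ℚ) / ((a + b).choose a : ℚ) := by
  obtain ⟨c, rfl⟩ : ∃ d, c = d + 1 := ⟨c - 1, by omega⟩
  have h1 := N1_mul_H (a + 1) (b + 1) c
  have h2 := N1_mul_H a b (c + 1)
  have h3 := Nat.add_choose_mul_factorial_mul_factorial a b
  have h4 := Nat.add_choose_mul_factorial_mul_factorial c (a + b + 1)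
  rw [← Nat.choose_symm_add] at h3 h4
  have hN := N1_pos a b (c + 1)
  have hC : 0 < (a + b).choose a := Nat.choose_pos (by omega)
  rw [add_tsub_cancel_right, div_eq_div_iff (by positivity) (by positivity)]
  rw [show a + 1 + (b + 1) = a + b + 1 + 1 by ring, show a + 1 + c = a + c + 1 by ring,
    show b + 1 + c = b + c + 1 by ring, show a + b + 1 + 1 + c = a + b + c + 1 + 1 by ring,
    H_succ (a + b + 1), H_succ (a + b), H_succ (a + b + c + 1), H_succ a, H_succ b] at h1
  rw [show a + b + (c + 1) = a + b + c + 1 by ring, show a + (c + 1) = a + c + 1 by ring,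
    show b + (c + 1) = b + c + 1 by ring, H_succ c] at h2
  rw [show c + (a + b + 1) = a + b + c + 1 by ring] at h4
  rw [show a + b + (c + 1) = a + b + c + 1 by ring]
  have hH := fun n => (Nat.cast_pos (α := ℚ)).2 (H_pos n)
  have hF := fun n => (Nat.cast_pos (α := ℚ)).2 (Nat.factorial_pos n)
  have e1 : (N1 (a + 1) (b + 1) c : ℚ) = H (a + b + c + 1) * (a + b + c + 1).factorial *
      (H a * a.factorial) * (H b * b.factorial) * H c / (H (a + b) * (a + b).factorial *
        (a + b + 1).factorial * H (a + c + 1) * H (b + c + 1)) := by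
    rw [eq_div_iff (by simp [(hH _).ne', (hF _).ne'])]
    exact_mod_cast h1
  have e2 : (N1 a b (c + 1) : ℚ) = H (a + b + c + 1) * H a * H b * (H c * c.factorial) /
      (H (a + b) * H (a + c + 1) * H (b + c + 1)) := by
    rw [eq_div_iff (by simp [(hH _).ne'])]
    exact_mod_cast h2
  have e3 : ((a + b).choose a : ℚ) = (a + b).factorial / (a.factorial * b.factorial) := by
    rw [eq_div_iff (by simp [(hF _).ne'])]
    exact_mod_cast (mul_assoc _ _ _).symm.trans h3
  have e4 : ((a + b + c + 1).choose c : ℚ) =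
      (a + b + c + 1).factorial / (c.factorial * (a + b + 1).factorial) := by
    rw [eq_div_iff (by simp [(hF _).ne'])]
    exact_mod_cast (mul_assoc _ _ _).symm.trans h4
  rw [e1, e2, e3, e4]
  have := hH (a + b)
  have := hH (a + c + 1)
  have := hH (b + c + 1)
  have := hF a
  have := hF b
  have := hF c
  have := hF (a + b)
  have := hF (a + b + 1)
  field_simp

/-! ### Adjacency of triangles in coordinates. -/

/-- Membership in the hexagon, in coordinates. -/
def InHex (a b c : ℕ) (x y : ℤ) : Prop :=
  0 ≤ x ∧ x ≤ b + c ∧ 0 ≤ y ∧ y ≤ a + b ∧ b ≤ x + y ∧ x + y ≤ a + b + c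

theorem mem_hexPoints {a b c : ℕ} {x y : ℤ} : (x, y) ∈ hexPoints a b c ↔ InHex a b c x y := by
  simp only [hexPoints, Finset.mem_filter, Finset.mem_product, Finset.mem_Icc, InHex]
  omega

theorem mem_upTriangles_iff {a b c : ℕ} {x y : ℤ} : (x, y) ∈ upTriangles a b c ↔
    0 ≤ x ∧ x + 1 ≤ b + c ∧ 0 ≤ y ∧ y + 1 ≤ a + b ∧ b ≤ x + y ∧ x + y + 1 ≤ a + b + c := by
  simp only [mem_upTriangles, upVerts, Finset.insert_subset_iff, Finset.singleton_subset_iff,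
    mem_hexPoints, InHex]
  omega

theorem mem_downTriangles_iff {a b c : ℕ} {x y : ℤ} : (x, y) ∈ downTriangles a b c ↔
    0 ≤ x ∧ x + 1 ≤ b + c ∧ 0 ≤ y ∧ y + 1 ≤ a + b ∧ b ≤ x + y + 1 ∧ x + y + 2 ≤ a + b + c := by
  simp only [mem_downTriangles, downVerts, Finset.insert_subset_iff, Finset.singleton_subset_iff,
    mem_hexPoints, InHex]
  omega

/-- The `∇` triangle `d` and the `Δ` triangle `u` of the lattice have a common side. -/
def TriAdj (d u : ℤ × ℤ) : Prop :=
  u = d ∨ u = (d.1 + 1, d.2) ∨ u = (d.1, d.2 + 1)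

theorem Z_adj_inl_inr {a b c : ℕ} (d : DownTri a b c) (u : UpTri a b c) :
    (Z a b c).Adj (Sum.inl d) (Sum.inr u) ↔ TriAdj d.1 u.1 := by
  obtain ⟨⟨x, y⟩, hd⟩ := d
  obtain ⟨⟨x', y'⟩, hu⟩ := u
  simp only [Z, triVerts, TriAdj, downVerts, upVerts, Prod.mk.injEq, ne_eq, reduceCtorEq,
    not_false_eq_true, true_and]
  constructor
  · intro h
    obtain ⟨⟨p, q⟩, hp, ⟨r, s⟩, hr, hne⟩ := Finset.one_lt_card.1 (h.ge.trans_lt' one_lt_two)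
    simp only [Finset.mem_inter, Finset.mem_insert, Finset.mem_singleton, Prod.mk.injEq, ne_eq]
      at hp hr hne
    omega
  · rintro (⟨rfl, rfl⟩ | ⟨rfl, rfl⟩ | ⟨rfl, rfl⟩)
    · rw [show ({(x' + 1, y'), (x', y' + 1), (x' + 1, y' + 1)} : Finset (ℤ × ℤ)) ∩
        {(x', y'), (x' + 1, y'), (x', y' + 1)} = {(x' + 1, y'), (x', y' + 1)} by
          ext ⟨p, q⟩
          simp only [Finset.mem_inter, Finset.mem_insert, Finset.mem_singleton, Prod.mk.injEq]
          omega]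
      exact Finset.card_pair (by simp)
    · rw [show ({(x + 1, y'), (x, y' + 1), (x + 1, y' + 1)} : Finset (ℤ × ℤ)) ∩
        {(x + 1, y'), (x + 1 + 1, y'), (x + 1, y' + 1)} = {(x + 1, y'), (x + 1, y' + 1)} by
          ext ⟨p, q⟩
          simp only [Finset.mem_inter, Finset.mem_insert, Finset.mem_singleton, Prod.mk.injEq]
          omega]
      exact Finset.card_pair (by simp)
    · rw [show ({(x' + 1, y), (x', y + 1), (x' + 1, y + 1)} : Finset (ℤ × ℤ)) ∩
        {(x', y + 1), (x' + 1, y + 1), (x', y + 1 + 1)} = {(x', y + 1), (x' + 1, y + 1)} by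
          ext ⟨p, q⟩
          simp only [Finset.mem_inter, Finset.mem_insert, Finset.mem_singleton, Prod.mk.injEq]
          omega]
      exact Finset.card_pair (by simp)

theorem not_Z_adj_inl_inl {a b c : ℕ} (d d' : DownTri a b c) :
    ¬ (Z a b c).Adj (Sum.inl d) (Sum.inl d') := by
  obtain ⟨⟨x, y⟩, hd⟩ := d
  obtain ⟨⟨x', y'⟩, hd'⟩ := d'
  simp only [Z, triVerts, downVerts, ne_eq, Sum.inl.injEq, Subtype.mk.injEq, Prod.mk.injEq]
  rintro ⟨hne', h⟩
  obtain ⟨⟨p, q⟩, hp, ⟨r, s⟩, hr, hne⟩ := Finset.one_lt_card.1 (h.ge.trans_lt' one_lt_two)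
  simp only [Finset.mem_inter, Finset.mem_insert, Finset.mem_singleton, Prod.mk.injEq, ne_eq]
    at hp hr hne
  omega

theorem not_Z_adj_inr_inr {a b c : ℕ} (u u' : UpTri a b c) :
    ¬ (Z a b c).Adj (Sum.inr u) (Sum.inr u') := by
  obtain ⟨⟨x, y⟩, hu⟩ := u
  obtain ⟨⟨x', y'⟩, hu'⟩ := u'
  simp only [Z, triVerts, upVerts, ne_eq, Sum.inr.injEq, Subtype.mk.injEq, Prod.mk.injEq]
  rintro ⟨hne', h⟩
  obtain ⟨⟨p, q⟩, hp, ⟨r, s⟩, hr, hne⟩ := Finset.one_lt_card.1 (h.ge.trans_lt' one_lt_two)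
  simp only [Finset.mem_inter, Finset.mem_insert, Finset.mem_singleton, Prod.mk.injEq, ne_eq]
    at hp hr hne
  omega

theorem Z_isBipartiteWith (a b c : ℕ) :
    (Z a b c).IsBipartiteWith (Set.range Sum.inl) (Set.range Sum.inr) where
  disjoint := Set.isCompl_range_inl_range_inr.disjoint
  mem_of_adj := by
    rintro (d | u) (d' | u') h
    · exact (not_Z_adj_inl_inl _ _ h).elim
    · exact Or.inl ⟨⟨d, rfl⟩, ⟨u', rfl⟩⟩
    · exact Or.inr ⟨⟨u, rfl⟩, ⟨d', rfl⟩⟩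
    · exact (not_Z_adj_inr_inr _ _ h).elim

/-! ### Height functions and their tilings. -/

/-- A height function on the hexagon: `F x y` is the second coordinate of the point above `(x, y)`
of a stack of cubes seen in isometric projection. -/
structure IsHeight (a b c : ℕ) (F : ℤ → ℤ → ℤ) : Prop where
  lower : ∀ x y, InHex a b c x y → 0 ≤ F x y ∧ x - c ≤ F x y ∧ b - y ≤ F x y
  upper : ∀ x y, InHex a b c x y → F x y ≤ b ∧ F x y ≤ x ∧ F x y ≤ a + b - y
  right : ∀ x y, InHex a b c x y → InHex a b c (x + 1) y → F x y ≤ F (x + 1) y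
  up : ∀ x y, InHex a b c x y → InHex a b c x (y + 1) → F x (y + 1) ≤ F x y
  diag : ∀ x y, InHex a b c (x + 1) y → InHex a b c x (y + 1) → F (x + 1) y ≤ F x (y + 1) + 1

/-- The three slacks of these inequalities are nonnegative integers with sum `1`, so exactly one
side of the triangle has slack `1`. That side is the diagonal of the lozenge; `downPartner` and
`upPartner` cross it. -/
theorem IsHeight.of_up {a b c : ℕ} {F : ℤ → ℤ → ℤ} (h : IsHeight a b c F) {x y : ℤ}
    (hu : (x, y) ∈ upTriangles a b c) :
    F x y ≤ F (x + 1) y ∧ F x (y + 1) ≤ F x y ∧ F (x + 1) y ≤ F x (y + 1) + 1 := by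
  rw [mem_upTriangles_iff] at hu
  exact ⟨h.right x y (by unfold InHex; omega) (by unfold InHex; omega),
    h.up x y (by unfold InHex; omega) (by unfold InHex; omega),
    h.diag x y (by unfold InHex; omega) (by unfold InHex; omega)⟩

theorem IsHeight.of_down {a b c : ℕ} {F : ℤ → ℤ → ℤ} (h : IsHeight a b c F) {x y : ℤ}
    (hd : (x, y) ∈ downTriangles a b c) :
    F x (y + 1) ≤ F (x + 1) (y + 1) ∧ F (x + 1) (y + 1) ≤ F (x + 1) y ∧
      F (x + 1) y ≤ F x (y + 1) + 1 := by
  rw [mem_downTriangles_iff] at hd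
  exact ⟨h.right x (y + 1) (by unfold InHex; omega) (by unfold InHex; omega),
    h.up (x + 1) y (by unfold InHex; omega) (by unfold InHex; omega),
    h.diag x y (by unfold InHex; omega) (by unfold InHex; omega)⟩

/-- The `Δ` triangle in the same lozenge as the `∇` triangle `p`. -/
def downPartner (F : ℤ → ℤ → ℤ) (p : ℤ × ℤ) : ℤ × ℤ :=
  if F (p.1 + 1) (p.2 + 1) ≠ F p.1 (p.2 + 1) then (p.1, p.2 + 1)
  else if F (p.1 + 1) p.2 ≠ F (p.1 + 1) (p.2 + 1) then (p.1 + 1, p.2) else p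

/-- The `∇` triangle in the same lozenge as the `Δ` triangle `p`. -/
def upPartner (F : ℤ → ℤ → ℤ) (p : ℤ × ℤ) : ℤ × ℤ :=
  if F (p.1 + 1) p.2 ≠ F p.1 p.2 then (p.1, p.2 - 1)
  else if F p.1 p.2 ≠ F p.1 (p.2 + 1) then (p.1 - 1, p.2) else p

theorem triAdj_downPartner (F : ℤ → ℤ → ℤ) (p : ℤ × ℤ) : TriAdj p (downPartner F p) := by
  unfold TriAdj downPartner
  split_ifs <;> simp

/-- On the sides of the hexagon the lower and upper bounds pin the heights, so a boundary side has
slack `0` and is never crossed. -/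
theorem IsHeight.downPartner_mem {a b c : ℕ} {F : ℤ → ℤ → ℤ} (h : IsHeight a b c F) {p : ℤ × ℤ}
    (hp : p ∈ downTriangles a b c) : downPartner F p ∈ upTriangles a b c := by
  obtain ⟨x, y⟩ := p
  have h0 := h.of_down hp
  rw [mem_downTriangles_iff] at hp
  have l1 := h.lower (x + 1) y (by unfold InHex; omega)
  have l2 := h.lower x (y + 1) (by unfold InHex; omega)
  have l3 := h.lower (x + 1) (y + 1) (by unfold InHex; omega)
  have u1 := h.upper (x + 1) y (by unfold InHex; omega)
  have u2 := h.upper x (y + 1) (by unfold InHex; omega)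
  have u3 := h.upper (x + 1) (y + 1) (by unfold InHex; omega)
  unfold downPartner
  split_ifs with h1 h2 <;> rw [mem_upTriangles_iff] <;> simp only at * <;> omega

theorem IsHeight.upPartner_mem {a b c : ℕ} {F : ℤ → ℤ → ℤ} (h : IsHeight a b c F) {p : ℤ × ℤ}
    (hp : p ∈ upTriangles a b c) : upPartner F p ∈ downTriangles a b c := by
  obtain ⟨x, y⟩ := p
  have h0 := h.of_up hp
  rw [mem_upTriangles_iff] at hp
  have l1 := h.lower x y (by unfold InHex; omega)
  have l2 := h.lower x (y + 1) (by unfold InHex; omega)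
  have l3 := h.lower (x + 1) y (by unfold InHex; omega)
  have u1 := h.upper x y (by unfold InHex; omega)
  have u2 := h.upper x (y + 1) (by unfold InHex; omega)
  have u3 := h.upper (x + 1) y (by unfold InHex; omega)
  unfold upPartner
  split_ifs with h1 h2 <;> rw [mem_downTriangles_iff] <;> simp only at * <;> omega

theorem IsHeight.upPartner_downPartner {a b c : ℕ} {F : ℤ → ℤ → ℤ} (h : IsHeight a b c F)
    {p : ℤ × ℤ} (hp : p ∈ downTriangles a b c) : upPartner F (downPartner F p) = p := by
  have hu := h.downPartner_mem hp
  obtain ⟨x, y⟩ := p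
  have h0 := h.of_down hp
  by_cases h1 : F (x + 1) (y + 1) = F x (y + 1)
  · by_cases h2 : F (x + 1) y = F (x + 1) (y + 1)
    · have e : downPartner F (x, y) = (x, y) := by simp [downPartner, h1, h2]
      rw [e] at hu ⊢
      have h3 := h.of_up hu
      have h4 : F (x + 1) y = F x y := by omega
      have h5 : F x y = F x (y + 1) := by omega
      simp [upPartner, h4, h5]
    · have e : downPartner F (x, y) = (x + 1, y) := by simp [downPartner, h1, h1 ▸ h2]
      rw [e] at hu ⊢
      have h3 := h.of_up hu
      have h4 : F (x + 1 + 1) y = F (x + 1) y := by omega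
      simp [upPartner, h4, h2]
  · have e : downPartner F (x, y) = (x, y + 1) := by simp [downPartner, h1]
    rw [e]
    simp [upPartner, h1]

theorem IsHeight.downPartner_upPartner {a b c : ℕ} {F : ℤ → ℤ → ℤ} (h : IsHeight a b c F)
    {p : ℤ × ℤ} (hp : p ∈ upTriangles a b c) : downPartner F (upPartner F p) = p := by
  have hd := h.upPartner_mem hp
  obtain ⟨x, y⟩ := p
  have h0 := h.of_up hp
  by_cases h1 : F (x + 1) y = F x y
  · by_cases h2 : F x y = F x (y + 1)
    · have e : upPartner F (x, y) = (x, y) := by simp [upPartner, h1, h2]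
      rw [e] at hd ⊢
      have h3 := h.of_down hd
      have h4 : F (x + 1) (y + 1) = F x (y + 1) := by omega
      have h5 : F (x + 1) y = F (x + 1) (y + 1) := by omega
      simp [downPartner, h4, h1, h2]
    · have e : upPartner F (x, y) = (x - 1, y) := by simp [upPartner, h1, h2]
      rw [e] at hd ⊢
      have h3 := h.of_down hd
      rw [sub_add_cancel] at h3
      have h4 : F x (y + 1) = F (x - 1) (y + 1) := by omega
      simp only [downPartner, sub_add_cancel, h4, ne_eq, not_true_eq_false, if_false]
      rw [if_pos (by omega)]
  · have e : upPartner F (x, y) = (x, y - 1) := by simp [upPartner, h1]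
    rw [e]
    simp [downPartner, h1]

/-- The lozenge tiling of a height function, as a bijection between the two kinds of triangles. -/
def heightEquiv {a b c : ℕ} (F : ℤ → ℤ → ℤ) (h : IsHeight a b c F) : DownTri a b c ≃ UpTri a b c where
  toFun d := ⟨downPartner F d.1, h.downPartner_mem d.2⟩
  invFun u := ⟨upPartner F u.1, h.upPartner_mem u.2⟩
  left_inv d := Subtype.ext (h.upPartner_downPartner d.2)
  right_inv u := Subtype.ext (h.downPartner_upPartner u.2)

/-- A height function can be read off from its tiling. -/
theorem IsHeight.eq_of_heightEquiv_eq {a b c : ℕ} {F F' : ℤ → ℤ → ℤ} (h : IsHeight a b c F)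
    (h' : IsHeight a b c F') (he : heightEquiv F h = heightEquiv F' h') {x y : ℤ}
    (hxy : InHex a b c x y) : F x y = F' x y := by
  -- Walk along a row from its left end, where both bounds agree. The partner of the `Δ` triangle
  -- above a horizontal edge tells whether the height rises; only the top row has no such triangle,
  -- and there the bounds force height `0`.
  have key : ∀ n : ℕ, InHex a b c (max 0 (b - y) + n) y →
      F (max 0 (b - y) + n) y = F' (max 0 (b - y) + n) y := by
    intro n
    induction n with
    | zero =>
      intro hn
      have h1 := h.lower _ _ hn
      have h2 := h.upper _ _ hn
      have h3 := h'.lower _ _ hn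
      have h4 := h'.upper _ _ hn
      push_cast at *
      unfold InHex at hn
      omega
    | succ n ih =>
      intro hn
      have hm : InHex a b c (max 0 (b - y) + n) y := by
        unfold InHex at *
        omega
      have ih := ih hm
      generalize hx : max 0 ((b : ℤ) - y) + (n : ℤ) = z at *
      rw [show max 0 ((b : ℤ) - y) + ((n + 1 : ℕ) : ℤ) = z + 1 by push_cast; omega] at hn ⊢
      by_cases hu : (z, y) ∈ upTriangles a b c
      · have e : upPartner F (z, y) = upPartner F' (z, y) :=
          congrArg (fun g : DownTri a b c ≃ UpTri a b c => (g.symm ⟨(z, y), hu⟩).1) he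
        have h1 := h.of_up hu
        have h2 := h'.of_up hu
        have e1 := congrArg Prod.fst e
        have e2 := congrArg Prod.snd e
        unfold upPartner at e1 e2
        simp only at e1 e2
        split_ifs at e1 e2 <;> simp only at e1 e2 <;> omega
      · rw [mem_upTriangles_iff] at hu
        have h1 := h.lower _ _ hn
        have h2 := h.upper _ _ hn
        have h3 := h'.lower _ _ hn
        have h4 := h'.upper _ _ hn
        unfold InHex at *
        omega
  have hx : max 0 ((b : ℤ) - y) + ((x - max 0 ((b : ℤ) - y)).toNat : ℕ) = x := by
    unfold InHex at hxy
    omega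
  have := key (x - max 0 ((b : ℤ) - y)).toNat
  rw [hx] at this
  exact this hxy

/-! ### Plane partitions and height functions. -/

/-- `F` is the height function of the stack of cubes `π`. -/
structure HasHeight (a b c : ℕ) (π : Finset (ℕ × ℕ × ℕ)) (F : ℤ → ℤ → ℤ) : Prop where
  isHeight : IsHeight a b c F
  mem_iff : ∀ x y z : ℕ, x < a → y < b → z < c →
    ((x, y, z) ∈ π ↔ (y : ℤ) < F (c + y - z) (b + x - y))

/-- If `F' < F` at the point, the cube on its line of sight with second coordinate `F' x y` is in
`π` but not in `π'`. Only cubes on this line matter, so the comparison is local. -/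
theorem HasHeight.le_of_imp {a b c : ℕ} {π π' : Finset (ℕ × ℕ × ℕ)} {F F' : ℤ → ℤ → ℤ}
    (h : HasHeight a b c π F) (h' : HasHeight a b c π' F') {x y : ℤ} (hxy : InHex a b c x y)
    (hi : ∀ i j k : ℕ, x = c + j - k → y = b + i - j → (i, j, k) ∈ π → (i, j, k) ∈ π') :
    F x y ≤ F' x y := by
  by_contra! hlt
  have h1 := h.isHeight.lower x y hxy
  have h2 := h.isHeight.upper x y hxy
  have h3 := h'.isHeight.lower x y hxy
  have h4 := h'.isHeight.upper x y hxy
  obtain ⟨j, hj⟩ : ∃ j : ℕ, F' x y = j := ⟨(F' x y).toNat, by omega⟩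
  obtain ⟨i, hi'⟩ : ∃ i : ℕ, y = b + i - j := ⟨(y - b + j).toNat, by omega⟩
  obtain ⟨k, hk⟩ : ∃ k : ℕ, x = c + j - k := ⟨(c + j - x).toNat, by omega⟩
  have m := h.mem_iff i j k (by omega) (by omega) (by omega)
  have m' := h'.mem_iff i j k (by omega) (by omega) (by omega)
  rw [← hk, ← hi'] at m m'
  have := m'.1 (hi i j k hk hi' (m.2 (by omega)))
  omega

theorem HasHeight.unique {a b c : ℕ} {π : Finset (ℕ × ℕ × ℕ)} {F F' : ℤ → ℤ → ℤ}
    (h : HasHeight a b c π F) (h' : HasHeight a b c π F') {x y : ℤ} (hxy : InHex a b c x y) :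
    F x y = F' x y :=
  le_antisymm (h.le_of_imp h' hxy fun _ _ _ _ _ => id) (h'.le_of_imp h hxy fun _ _ _ _ _ => id)

theorem HasHeight.eq_of_eq {a b c : ℕ} {π π' : Finset (ℕ × ℕ × ℕ)} {F F' : ℤ → ℤ → ℤ}
    (hb : π ⊆ box a b c) (hb' : π' ⊆ box a b c)
    (h : HasHeight a b c π F) (h' : HasHeight a b c π' F')
    (he : ∀ x y, InHex a b c x y → F x y = F' x y) : π = π' := by
  ext ⟨x, y, z⟩
  by_cases hm : (x, y, z) ∈ box a b c
  · rw [mem_box] at hm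
    rw [h.mem_iff x y z hm.1 hm.2.1 hm.2.2, h'.mem_iff x y z hm.1 hm.2.1 hm.2.2,
      he _ _ (by unfold InHex; omega)]
  · exact iff_of_false (fun h => hm (hb h)) (fun h => hm (hb' h))

theorem exists_threshold {P : ℤ → Prop} {l u : ℤ} (hlu : l ≤ u)
    (hP : ∀ s t, l ≤ s → s ≤ t → t < u → P t → P s) :
    ∃ n, l ≤ n ∧ n ≤ u ∧ ∀ t, l ≤ t → t < u → (P t ↔ t < n) := by
  induction u, hlu using Int.leInduction with
  | base => exact ⟨l, le_rfl, le_rfl, fun t h1 h2 => by omega⟩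
  | succ u hlu ih =>
    by_cases hu : P u
    · exact ⟨u + 1, by omega, le_rfl, fun t h1 h2 =>
        iff_of_true (hP t u h1 (by omega) (by omega) hu) h2⟩
    · obtain ⟨n, h1, h2, h3⟩ := ih fun s t hs hst ht => hP s t hs hst (by omega)
      refine ⟨n, h1, by omega, fun t h4 h5 => ?_⟩
      rcases (show t < u ∨ t = u by omega) with h | rfl
      · exact h3 t h4 h
      · exact iff_of_false hu (by omega)

theorem exists_hasHeight {a b c : ℕ} {π : Finset (ℕ × ℕ × ℕ)} (hπ : IsPlanePartition π) :
    ∃ F, HasHeight a b c π F := by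
  -- The line of sight over `(x, y)` consists of the points `(y - b + t, t, c + t - x)`; the bounds
  -- on `t` are where it enters and leaves the box. An order ideal meets it in an initial segment,
  -- and `F` is the end of that segment.
  have key : ∀ x y : ℤ, ∃ n, InHex a b c x y →
      (0 ≤ n ∧ x - c ≤ n ∧ b - y ≤ n) ∧ (n ≤ b ∧ n ≤ x ∧ n ≤ a + b - y) ∧
      ∀ t : ℤ, 0 ≤ t → x - c ≤ t → b - y ≤ t → t < b → t < x → t < a + b - y →
        (((y - b + t).toNat, t.toNat, (c + t - x).toNat) ∈ π ↔ t < n) := by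
    intro x y
    by_cases hxy : InHex a b c x y
    · unfold InHex at hxy
      obtain ⟨n, h1, h2, h3⟩ := exists_threshold
        (P := fun t : ℤ => ((y - b + t).toNat, t.toNat, (c + t - x).toNat) ∈ π)
        (l := max 0 (max (x - c) (b - y))) (u := min b (min x (a + b - y))) (by omega)
        (fun s t hs hst ht => hπ.mem_of_le (by omega) (by omega) (by omega))
      exact ⟨n, fun _ => ⟨by omega, by omega, fun t _ _ _ _ _ _ => h3 t (by omega) (by omega)⟩⟩
    · exact ⟨0, fun h => (hxy h).elim⟩
  choose F hF using key
  refine ⟨F, ⟨fun x y h => (hF x y h).1, fun x y h => (hF x y h).2.1, ?_, ?_, ?_⟩, ?_⟩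
  · intro x y h1 h2
    obtain ⟨a1, a2, a3⟩ := hF _ _ h1
    obtain ⟨b1, b2, b3⟩ := hF _ _ h2
    by_contra! hlt
    have m1 := a3 (F (x + 1) y) (by omega) (by omega) (by omega) (by omega) (by omega) (by omega)
    have m2 := b3 (F (x + 1) y) (by omega) (by omega) (by omega) (by omega) (by omega) (by omega)
    exact lt_irrefl _ (m2.1 (hπ.mem_of_le (by omega) (by omega) (by omega) (m1.2 hlt)))
  · intro x y h1 h2
    obtain ⟨a1, a2, a3⟩ := hF _ _ h1
    obtain ⟨b1, b2, b3⟩ := hF _ _ h2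
    by_contra! hlt
    have m1 := a3 (F x y) (by omega) (by omega) (by omega) (by omega) (by omega) (by omega)
    have m2 := b3 (F x y) (by omega) (by omega) (by omega) (by omega) (by omega) (by omega)
    exact lt_irrefl _ (m1.1 (hπ.mem_of_le (by omega) (by omega) (by omega) (m2.2 hlt)))
  · intro x y h1 h2
    obtain ⟨a1, a2, a3⟩ := hF _ _ h1
    obtain ⟨b1, b2, b3⟩ := hF _ _ h2
    by_contra! hlt
    have m1 := a3 (F x (y + 1) + 1) (by omega) (by omega) (by omega) (by omega) (by omega)
      (by omega)
    have m2 := b3 (F x (y + 1)) (by omega) (by omega) (by omega) (by omega) (by omega) (by omega)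
    exact lt_irrefl _ (m2.1 (hπ.mem_of_le (by omega) (by omega) (by omega) (m1.2 hlt)))
  · intro x y z hx hy hz
    have h := (hF (c + y - z) (b + x - y) (by unfold InHex; omega)).2.2 y
      (by omega) (by omega) (by omega) (by omega) (by omega) (by omega)
    rw [show ((b : ℤ) + x - y - b + y).toNat = x by omega, Int.toNat_natCast,
      show ((c : ℤ) + y - (c + y - z)).toNat = z by omega] at h
    exact h

theorem isPlanePartition_of_succ {π : Finset (ℕ × ℕ × ℕ)}
    (h1 : ∀ x y z, (x + 1, y, z) ∈ π → (x, y, z) ∈ π)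
    (h2 : ∀ x y z, (x, y + 1, z) ∈ π → (x, y, z) ∈ π)
    (h3 : ∀ x y z, (x, y, z + 1) ∈ π → (x, y, z) ∈ π) : IsPlanePartition π := by
  rintro ⟨x, y, z⟩ ⟨x', y', z'⟩ ⟨hx, hy, hz⟩ hm
  simp only [Finset.mem_coe] at *
  obtain ⟨i, rfl⟩ := Nat.exists_eq_add_of_le hx
  obtain ⟨j, rfl⟩ := Nat.exists_eq_add_of_le hy
  obtain ⟨k, rfl⟩ := Nat.exists_eq_add_of_le hz
  have e1 : (x', y' + j, z' + k) ∈ π := by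
    induction i with
    | zero => exact hm
    | succ i ih => exact ih (by omega) (h1 _ _ _ hm)
  have e2 : (x', y', z' + k) ∈ π := by
    induction j with
    | zero => exact e1
    | succ j ih => exact ih (by omega) (h2 _ _ _ hm) (h2 _ _ _ e1)
  induction k with
  | zero => exact e2
  | succ k ih => exact ih (by omega) (h3 _ _ _ hm) (h3 _ _ _ e1) (h3 _ _ _ e2)

theorem IsHeight.exists_planePartition {a b c : ℕ} {F : ℤ → ℤ → ℤ} (h : IsHeight a b c F) :
    ∃ π : PP a b c, HasHeight a b c π.1 F := by
  have hm : ∀ x y z, (x, y, z) ∈ (box a b c).filter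
      (fun v => (v.2.1 : ℤ) < F (c + v.2.1 - v.2.2) (b + v.1 - v.2.1)) ↔
      (x < a ∧ y < b ∧ z < c) ∧ (y : ℤ) < F (c + y - z) (b + x - y) := fun x y z => by
    rw [Finset.mem_filter, mem_box]
  refine ⟨⟨(box a b c).filter
    (fun v => (v.2.1 : ℤ) < F (c + v.2.1 - v.2.2) (b + v.1 - v.2.1)),
    Finset.filter_subset _ _, isPlanePartition_of_succ ?_ ?_ ?_⟩, h, ?_⟩
  · intro x y z
    rw [hm, hm]
    rintro ⟨h1, h2⟩
    have := h.up (c + y - z) (b + x - y) (by unfold InHex; omega) (by unfold InHex; omega)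
    rw [show (b : ℤ) + (x + 1 : ℕ) - y = b + x - y + 1 by push_cast; ring] at h2
    exact ⟨by omega, by omega⟩
  · intro x y z
    rw [hm, hm]
    rintro ⟨h1, h2⟩
    have := h.diag (c + y - z) (b + x - y - 1) (by unfold InHex; omega) (by unfold InHex; omega)
    rw [show (b : ℤ) + x - (y + 1 : ℕ) = b + x - y - 1 by push_cast; ring,
      show (c : ℤ) + (y + 1 : ℕ) - z = c + y - z + 1 by push_cast; ring] at h2
    rw [sub_add_cancel] at this
    exact ⟨by omega, by push_cast at h2; omega⟩
  · intro x y z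
    rw [hm, hm]
    rintro ⟨h1, h2⟩
    have := h.right (c + y - z - 1) (b + x - y) (by unfold InHex; omega) (by unfold InHex; omega)
    rw [show (c : ℤ) + y - (z + 1 : ℕ) = c + y - z - 1 by push_cast; ring] at h2
    rw [sub_add_cancel] at this
    exact ⟨by omega, by omega⟩
  · intro x y z hx hy hz
    rw [hm]
    exact and_iff_right ⟨hx, hy, hz⟩

/-! ### The height function of a tiling -/

/-- A lozenge tiling of the hexagon, as a bijection between `∇` and `Δ` triangles. -/
abbrev Tiling (a b c : ℕ) : Type :=
  {g : DownTri a b c ≃ UpTri a b c // ∀ d, TriAdj d.1 (g d).1}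

open Classical in
/-- `1` if `p` and `q` are a `∇` and a `Δ` triangle that are matched by `g`, else `0`. -/
noncomputable def joined {a b c : ℕ} (g : DownTri a b c ≃ UpTri a b c) (p q : ℤ × ℤ) : ℤ :=
  if ∃ d : DownTri a b c, d.1 = p ∧ (g d).1 = q then 1 else 0

section
variable {a b c : ℕ} (g : DownTri a b c ≃ UpTri a b c)

theorem joined_nonneg (p q : ℤ × ℤ) : 0 ≤ joined g p q := by
  unfold joined
  split_ifs <;> simp

theorem joined_le_one (p q : ℤ × ℤ) : joined g p q ≤ 1 := by
  unfold joined
  split_ifs <;> simp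

/-- Since `joined` takes arbitrary lattice points, boundary edges need no separate treatment: one of
their two triangles is missing, so their indicator vanishes. -/
theorem joined_eq_zero_of_down {p : ℤ × ℤ} (hp : p ∉ downTriangles a b c) (q : ℤ × ℤ) :
    joined g p q = 0 := by
  refine if_neg ?_
  rintro ⟨d, rfl, -⟩
  exact hp d.2

theorem joined_eq_zero_of_up (p : ℤ × ℤ) {q : ℤ × ℤ} (hq : q ∉ upTriangles a b c) :
    joined g p q = 0 := by
  refine if_neg ?_
  rintro ⟨d, -, rfl⟩
  exact hq (g d).2

theorem joined_of_down (d : DownTri a b c) (q : ℤ × ℤ) [Decidable ((g d).1 = q)] :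
    joined g d.1 q = if (g d).1 = q then 1 else 0 := by
  unfold joined
  congr 1
  refine propext ⟨?_, fun h => ⟨d, rfl, h⟩⟩
  rintro ⟨d', h, h'⟩
  rwa [Subtype.ext h] at h'

theorem joined_of_up (p : ℤ × ℤ) (u : UpTri a b c) [Decidable ((g.symm u).1 = p)] :
    joined g p u.1 = if (g.symm u).1 = p then 1 else 0 := by
  unfold joined
  congr 1
  refine propext ⟨?_, fun h => ⟨g.symm u, h, by simp⟩⟩
  rintro ⟨d', h, h'⟩
  rw [← Subtype.ext h', Equiv.symm_apply_apply, h]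

end

section
variable {a b c : ℕ} (g : Tiling a b c)

/-- The indicator of a horizontal edge being the diagonal of a lozenge. -/
noncomputable def crossA (x y : ℤ) : ℤ := joined g.1 (x, y - 1) (x, y)

/-- The indicator of an edge in direction `(0, 1)` being the diagonal of a lozenge. -/
noncomputable def crossB (x y : ℤ) : ℤ := joined g.1 (x - 1, y) (x, y)

/-- The indicator of an edge in direction `(-1, 1)` being the diagonal of a lozenge. -/
noncomputable def crossC (x y : ℤ) : ℤ := joined g.1 (x, y) (x, y)

theorem cross_up {x y : ℤ} (h : (x, y) ∈ upTriangles a b c) :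
    crossA g x y + crossB g x y + crossC g x y = 1 := by
  have h1 := g.2 (g.1.symm ⟨(x, y), h⟩)
  have hA := joined_of_up g.1 (x, y - 1) ⟨(x, y), h⟩
  have hB := joined_of_up g.1 (x - 1, y) ⟨(x, y), h⟩
  have hC := joined_of_up g.1 (x, y) ⟨(x, y), h⟩
  rw [Equiv.apply_symm_apply] at h1
  generalize (g.1.symm ⟨(x, y), h⟩).1 = p at *
  obtain ⟨p, q⟩ := p
  simp only [TriAdj, Prod.mk.injEq] at *
  unfold crossA crossB crossC
  rw [hA, hB, hC]
  split_ifs <;> omega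

theorem cross_down {x y : ℤ} (h : (x, y) ∈ downTriangles a b c) :
    crossA g x (y + 1) + crossB g (x + 1) y + crossC g x y = 1 := by
  have h1 := g.2 ⟨(x, y), h⟩
  have hA := joined_of_down g.1 ⟨(x, y), h⟩ (x, y + 1)
  have hB := joined_of_down g.1 ⟨(x, y), h⟩ (x + 1, y)
  have hC := joined_of_down g.1 ⟨(x, y), h⟩ (x, y)
  generalize (g.1 ⟨(x, y), h⟩).1 = p at *
  obtain ⟨p, q⟩ := p
  simp only [TriAdj, Prod.mk.injEq] at *
  unfold crossA crossB crossC
  rw [add_sub_cancel_right, add_sub_cancel_right, hA, hB, hC]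
  split_ifs <;> omega

/-- The height function of a tiling. -/
noncomputable def tilingHeight (x y : ℤ) : ℤ :=
  max 0 (b - y) + ∑ t ∈ Finset.Ico (max 0 (b - y)) x, crossA g t y

theorem tilingHeight_left {x y : ℤ} (h : x = max 0 (b - y)) : tilingHeight g x y = x := by
  rw [tilingHeight, ← h]
  simp

theorem tilingHeight_right {x y : ℤ} (h : max 0 (b - y) ≤ x) :
    tilingHeight g (x + 1) y = tilingHeight g x y + crossA g x y := by
  unfold tilingHeight
  rw [add_assoc, ← Finset.sum_Ico_add_eq_sum_Ico_add_one h]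

/-- The height is defined by horizontal steps only; this is its path independence. Each lattice
triangle has exactly one crossed side, so `cross_up` and `cross_down` have the same total and the
increments close up around every unit rhombus. -/
theorem tilingHeight_up {x y : ℤ} (h1 : InHex a b c x y) (h2 : InHex a b c x (y + 1)) :
    tilingHeight g x (y + 1) = tilingHeight g x y - crossB g x y := by
  have hx : max 0 ((b : ℤ) - y) ≤ x := by
    unfold InHex at *
    omega
  induction x, hx using Int.leInduction with
  | base =>
    rw [tilingHeight_left g rfl]
    by_cases hy : (b : ℤ) ≤ y
    · have e : max 0 ((b : ℤ) - y) = 0 := by omega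
      rw [e, tilingHeight_left g (by omega), crossB,
        joined_eq_zero_of_down _ (by rw [mem_downTriangles_iff]; omega)]
      rfl
    · have e : max 0 ((b : ℤ) - y) = b - (y + 1) + 1 := by omega
      unfold InHex at *
      rw [e, tilingHeight_right g (by omega), tilingHeight_left g (by omega)]
      have h3 := cross_down g (x := b - (y + 1)) (y := y) (by rw [mem_downTriangles_iff]; omega)
      have h4 : crossC g (b - (y + 1)) y = 0 :=
        joined_eq_zero_of_up _ _ (by rw [mem_upTriangles_iff]; omega)
      omega
  | succ x hx ih =>
    have h3 : InHex a b c x y := by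
      unfold InHex at *
      omega
    have h4 : InHex a b c x (y + 1) := by
      unfold InHex at *
      omega
    have ih := ih h3 h4
    have h5 := cross_up g (x := x) (y := y) (by
      unfold InHex at *
      rw [mem_upTriangles_iff]
      omega)
    have h6 := cross_down g (x := x) (y := y) (by
      unfold InHex at *
      rw [mem_downTriangles_iff]
      omega)
    rw [tilingHeight_right g hx, tilingHeight_right g (by omega)]
    omega

theorem tilingHeight_right_end {y : ℤ} (hy : 0 ≤ y) (hy' : y ≤ a + b) :
    tilingHeight g (min ((b : ℤ) + c) (a + b + c - y)) y = min ((b : ℤ) + c) (a + b + c - y) - c := by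
  induction y, hy using Int.leInduction with
  | base =>
    have e : min ((b : ℤ) + c) (a + b + c - 0) = b + c := by omega
    rw [e, tilingHeight, Finset.sum_eq_zero]
    · omega
    · intro t _
      exact joined_eq_zero_of_down _ (by rw [mem_downTriangles_iff]; omega) _
  | succ y hy ih =>
    have ih := ih (by omega)
    by_cases ha : y < a
    · have e1 : min ((b : ℤ) + c) (a + b + c - y) = b + c := by omega
      have e2 : min ((b : ℤ) + c) (a + b + c - (y + 1)) = b + c := by omega
      rw [e1] at ih
      rw [e2, tilingHeight_up g (by unfold InHex; omega) (by unfold InHex; omega), ih, crossB,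
        joined_eq_zero_of_up _ _ (by rw [mem_upTriangles_iff]; omega), sub_zero]
    -- The hexagon is then a segment without triangles, and each row is a single point.
    · by_cases hac : a + c = 0
      · rw [tilingHeight_left g (by omega)]
        omega
      · have e1 : min ((b : ℤ) + c) (a + b + c - y) = a + b + c - (y + 1) + 1 := by omega
        have e2 : min ((b : ℤ) + c) (a + b + c - (y + 1)) = a + b + c - (y + 1) := by omega
        rw [e1, tilingHeight_right g (by omega)] at ih
        rw [e2, tilingHeight_up g (by unfold InHex; omega) (by unfold InHex; omega)]
        have h3 := cross_up g (x := a + b + c - (y + 1)) (y := y)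
          (by rw [mem_upTriangles_iff]; omega)
        have h4 : crossC g (a + b + c - (y + 1)) y = 0 :=
          joined_eq_zero_of_down _ (by rw [mem_downTriangles_iff]; omega) _
        omega

theorem tilingHeight_add_le {x y : ℤ} (h : max 0 (b - y) ≤ x) (n : ℕ) :
    tilingHeight g x y ≤ tilingHeight g (x + n) y ∧
      tilingHeight g (x + n) y ≤ tilingHeight g x y + n := by
  induction n with
  | zero => simp
  | succ n ih =>
    have h1 := tilingHeight_right g (x := x + n) (y := y) (by omega)
    have h2 : 0 ≤ crossA g (x + n) y := joined_nonneg _ _ _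
    have h3 : crossA g (x + n) y ≤ 1 := joined_le_one _ _ _
    push_cast
    rw [← add_assoc]
    omega

theorem isHeight_tilingHeight : IsHeight a b c (tilingHeight g) := by
  have bounds : ∀ x y, InHex a b c x y →
      (0 ≤ tilingHeight g x y ∧ x - c ≤ tilingHeight g x y ∧ b - y ≤ tilingHeight g x y) ∧
      (tilingHeight g x y ≤ b ∧ tilingHeight g x y ≤ x ∧ tilingHeight g x y ≤ a + b - y) := by
    intro x y h
    unfold InHex at h
    -- A step to the right raises the height by `0` or `1`, so the known values at the two ends of
    -- the row imply all six bounds.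
    have h1 := tilingHeight_add_le g (x := max 0 (b - y)) (y := y) le_rfl
      (x - max 0 (b - y)).toNat
    have h2 := tilingHeight_add_le g (x := x) (y := y) (by omega)
      (min ((b : ℤ) + c) (a + b + c - y) - x).toNat
    rw [show max 0 ((b : ℤ) - y) + (x - max 0 (b - y)).toNat = x by omega,
      tilingHeight_left g rfl] at h1
    rw [show x + (min ((b : ℤ) + c) (a + b + c - y) - x).toNat = min ((b : ℤ) + c) (a + b + c - y) by
      omega, tilingHeight_right_end g (by omega) (by omega)] at h2
    omega
  have hA : ∀ x y, 0 ≤ crossA g x y := fun x y => joined_nonneg _ _ _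
  have hB : ∀ x y, 0 ≤ crossB g x y := fun x y => joined_nonneg _ _ _
  have hC : ∀ x y, 0 ≤ crossC g x y := fun x y => joined_nonneg _ _ _
  refine ⟨fun x y h => (bounds x y h).1, fun x y h => (bounds x y h).2, ?_, ?_, ?_⟩
  · intro x y h1 h2
    rw [tilingHeight_right g (by unfold InHex at h1; omega)]
    have := hA x y
    omega
  · intro x y h1 h2
    rw [tilingHeight_up g h1 h2]
    have := hB x y
    omega
  · intro x y h1 h2
    by_cases h3 : InHex a b c x y
    · have e1 := tilingHeight_right g (x := x) (y := y) (by unfold InHex at h3; omega)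
      have e2 := tilingHeight_up g h3 h2
      have e3 := cross_up g (x := x) (y := y) (by
        unfold InHex at *
        rw [mem_upTriangles_iff]
        omega)
      have := hC x y
      omega
    · by_cases h4 : InHex a b c (x + 1) (y + 1)
      · have e1 := tilingHeight_right g (x := x) (y := y + 1) (by unfold InHex at h2; omega)
        have e2 := tilingHeight_up g h1 h4
        have e3 := cross_down g (x := x) (y := y) (by
          unfold InHex at *
          rw [mem_downTriangles_iff]
          omega)
        have := hC x y
        omega
      -- An edge with no triangle on either side exists only for `a = c = 0`; the bounds then
      -- suffice.
      · have b1 := bounds _ _ h1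
        have b2 := bounds _ _ h2
        unfold InHex at *
        omega

theorem heightEquiv_tilingHeight : heightEquiv _ (isHeight_tilingHeight g) = g.1 := by
  ext1 d
  apply Subtype.ext
  obtain ⟨⟨x, y⟩, hd⟩ := d
  change downPartner (tilingHeight g) (x, y) = _
  have hd' := mem_downTriangles_iff.1 hd
  have h1 := g.2 ⟨(x, y), hd⟩
  have hA := joined_of_down g.1 ⟨(x, y), hd⟩ (x, y + 1)
  have hB := joined_of_down g.1 ⟨(x, y), hd⟩ (x + 1, y)
  have e1 := tilingHeight_right g (x := x) (y := y + 1) (by omega)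
  have e2 := tilingHeight_up g (x := x + 1) (y := y) (by unfold InHex; omega)
    (by unfold InHex; omega)
  unfold crossA at e1
  unfold crossB at e2
  rw [add_sub_cancel_right] at e1 e2
  simp only at hA hB
  rw [hA] at e1
  rw [hB] at e2
  generalize (g.1 ⟨(x, y), hd⟩).1 = p at *
  obtain ⟨p, q⟩ := p
  simp only [TriAdj, Prod.mk.injEq] at *
  unfold downPartner
  simp only
  split_ifs at e1 e2 ⊢ <;> simp only [Prod.mk.injEq] <;> omega

end

/-! ### The bijection between plane partitions and tilings. -/

theorem heightEquiv_congr {a b c : ℕ} {F F' : ℤ → ℤ → ℤ} (h : IsHeight a b c F)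
    (h' : IsHeight a b c F') (he : ∀ x y, InHex a b c x y → F x y = F' x y) :
    heightEquiv F h = heightEquiv F' h' := by
  ext1 d
  apply Subtype.ext
  obtain ⟨⟨x, y⟩, hd⟩ := d
  change downPartner F (x, y) = downPartner F' (x, y)
  rw [mem_downTriangles_iff] at hd
  unfold downPartner
  rw [he (x + 1) (y + 1) (by unfold InHex; omega), he x (y + 1) (by unfold InHex; omega),
    he (x + 1) y (by unfold InHex; omega)]

/-- The tiling of a plane partition. -/
noncomputable def ppTiling {a b c : ℕ} (π : PP a b c) : Tiling a b c :=
  ⟨heightEquiv _ (exists_hasHeight π.2.2).choose_spec.isHeight, fun d =>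
    triAdj_downPartner _ d.1⟩

theorem HasHeight.ppTiling_eq {a b c : ℕ} {π : PP a b c} {F : ℤ → ℤ → ℤ}
    (h : HasHeight a b c π.1 F) : (ppTiling π).1 = heightEquiv F h.isHeight :=
  heightEquiv_congr (exists_hasHeight π.2.2).choose_spec.isHeight h.isHeight fun _ _ hxy =>
    (exists_hasHeight π.2.2).choose_spec.unique h hxy

theorem ppTiling_bijective (a b c : ℕ) :
    Function.Bijective (ppTiling (a := a) (b := b) (c := c)) := by
  constructor
  · intro π π' he
    have h := (exists_hasHeight (a := a) (b := b) (c := c) π.2.2).choose_spec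
    have h' := (exists_hasHeight (a := a) (b := b) (c := c) π'.2.2).choose_spec
    exact Subtype.ext (h.eq_of_eq π.2.1 π'.2.1 h' fun x y hxy =>
      h.isHeight.eq_of_heightEquiv_eq h'.isHeight (congrArg Subtype.val he) hxy)
  · intro g
    obtain ⟨π, hπ⟩ := (isHeight_tilingHeight g).exists_planePartition
    exact ⟨π, Subtype.ext (hπ.ppTiling_eq.trans (heightEquiv_tilingHeight g))⟩

theorem card_tiling (a b c : ℕ) : Nat.card (Tiling a b c) = N1 a b c := by
  rw [← card_PP]
  exact (Nat.card_congr (Equiv.ofBijective _ (ppTiling_bijective a b c))).symm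

/-! ### All tilings have the same sign. -/

/-- Lowering a height function at one point rotates three lozenges. -/
theorem IsHeight.exists_perm_of_flip {a b c : ℕ} {F F' : ℤ → ℤ → ℤ} (h : IsHeight a b c F)
    (h' : IsHeight a b c F') {x y : ℤ}
    (hne : ∀ s t, InHex a b c s t → s ≠ x ∨ t ≠ y → F' s t = F s t)
    (hlt : F' x y < F x y) (h1 : InHex a b c (x + 1) (y - 1)) (h2 : InHex a b c (x - 1) (y + 1))
    (h3 : InHex a b c (x - 1) y) (h4 : InHex a b c (x + 1) y)
    (h5 : InHex a b c x (y - 1)) (h6 : InHex a b c x (y + 1)) :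
    ∃ τ : Equiv.Perm (DownTri a b c), Equiv.Perm.sign τ = 1 ∧
      heightEquiv F' h' = τ.trans (heightEquiv F h) := by
  have h0 : InHex a b c x y := by
    unfold InHex at *
    omega
  have m1 : (x - 1, y) ∈ downTriangles a b c := by
    rw [mem_downTriangles_iff]
    unfold InHex at *
    omega
  have m2 : (x, y - 1) ∈ downTriangles a b c := by
    rw [mem_downTriangles_iff]
    unfold InHex at *
    omega
  have m3 : (x - 1, y - 1) ∈ downTriangles a b c := by
    rw [mem_downTriangles_iff]
    unfold InHex at *
    omega
  have n1 := hne _ _ h1 (by omega)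
  have n2 := hne _ _ h2 (by omega)
  have n3 := hne _ _ h3 (by omega)
  have n4 := hne _ _ h4 (by omega)
  have n5 := hne _ _ h5 (by omega)
  have n6 := hne _ _ h6 (by omega)
  have a1 := h.right x y h0 h4
  have a2 := h.right (x - 1) y h3 (by rwa [sub_add_cancel])
  have a3 := h.up x y h0 h6
  have a4 := h.up x (y - 1) h5 (by rwa [sub_add_cancel])
  have a5 := h.diag (x - 1) y (by rwa [sub_add_cancel]) h2
  have a6 := h.diag x (y - 1) h1 (by rwa [sub_add_cancel])
  have a7 := h.right x (y - 1) h5 h1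
  have a8 := h.right (x - 1) (y + 1) h2 (by rwa [sub_add_cancel])
  have a9 := h.up (x + 1) (y - 1) h1 (by rwa [sub_add_cancel])
  have a10 := h.up (x - 1) y h3 h2
  have b1 := h'.right x y h0 h4
  have b2 := h'.right (x - 1) y h3 (by rwa [sub_add_cancel])
  have b3 := h'.up x y h0 h6
  have b4 := h'.up x (y - 1) h5 (by rwa [sub_add_cancel])
  have b5 := h'.diag (x - 1) y (by rwa [sub_add_cancel]) h2
  have b6 := h'.diag x (y - 1) h1 (by rwa [sub_add_cancel])
  rw [sub_add_cancel] at a2 a4 a5 a6 a8 a9 b2 b4 b5 b6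
  -- Both functions are admissible with the same six neighbours but different centres, which
  -- determines all seven values up to a constant.
  have p1 : F x y = F' x y + 1 := by omega
  have p2 : F (x + 1) y = F' x y + 1 := by omega
  have p3 : F x (y - 1) = F' x y + 1 := by omega
  have p4 : F (x + 1) (y - 1) = F' x y + 1 := by omega
  have p5 : F (x - 1) y = F' x y := by omega
  have p6 : F x (y + 1) = F' x y := by omega
  have p7 : F (x - 1) (y + 1) = F' x y := by omega
  have e1 : downPartner F (x - 1, y) = (x, y) := by simp [downPartner, p6, p7, p1]
  have e2 : downPartner F (x, y - 1) = (x, y - 1) := by simp [downPartner, p1, p2, p4]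
  have e3 : downPartner F (x - 1, y - 1) = (x - 1, y) := by simp [downPartner, p1, p5]
  have e1' : downPartner F' (x - 1, y) = (x - 1, y) := by simp [downPartner, n6, n2, p6, p7]
  have e2' : downPartner F' (x, y - 1) = (x, y) := by simp [downPartner, n4, p2]
  have e3' : downPartner F' (x - 1, y - 1) = (x, y - 1) := by
    simp [downPartner, n3, n5, p3, p5]
  have d12 : (⟨(x - 1, y), m1⟩ : DownTri a b c) ≠ ⟨(x, y - 1), m2⟩ := by simp
  have d13 : (⟨(x - 1, y), m1⟩ : DownTri a b c) ≠ ⟨(x - 1, y - 1), m3⟩ := by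
    simp only [ne_eq, Subtype.mk.injEq, Prod.mk.injEq]
    omega
  have d23 : (⟨(x, y - 1), m2⟩ : DownTri a b c) ≠ ⟨(x - 1, y - 1), m3⟩ := by
    simp only [ne_eq, Subtype.mk.injEq, Prod.mk.injEq]
    omega
  -- Only the three `∇` triangles around the point change partner, cyclically: a 3-cycle, written as
  -- two transpositions.
  refine ⟨Equiv.swap ⟨(x, y - 1), m2⟩ ⟨(x - 1, y), m1⟩ *
    Equiv.swap ⟨(x - 1, y), m1⟩ ⟨(x - 1, y - 1), m3⟩, ?_, ?_⟩
  · rw [Equiv.Perm.sign_mul, Equiv.Perm.sign_swap d12.symm, Equiv.Perm.sign_swap d13]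
    rfl
  · ext1 d
    rw [Equiv.trans_apply, Equiv.Perm.mul_apply]
    apply Subtype.ext
    by_cases c1 : d = ⟨(x - 1, y), m1⟩
    · rw [c1, Equiv.swap_apply_left, Equiv.swap_apply_of_ne_of_ne d23.symm d13.symm]
      exact e1'.trans e3.symm
    by_cases c2 : d = ⟨(x, y - 1), m2⟩
    · rw [c2, Equiv.swap_apply_of_ne_of_ne d12.symm d23, Equiv.swap_apply_left]
      exact e2'.trans e1.symm
    by_cases c3 : d = ⟨(x - 1, y - 1), m3⟩
    · rw [c3, Equiv.swap_apply_right, Equiv.swap_apply_right]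
      exact e3'.trans e2.symm
    rw [Equiv.swap_apply_of_ne_of_ne c1 c3, Equiv.swap_apply_of_ne_of_ne c2 c1]
    obtain ⟨⟨s, t⟩, hd⟩ := d
    change downPartner F' (s, t) = downPartner F (s, t)
    rw [mem_downTriangles_iff] at hd
    simp only [Subtype.mk.injEq, Prod.mk.injEq] at c1 c2 c3
    unfold downPartner
    rw [hne (s + 1) (t + 1) (by unfold InHex; omega) (by omega),
      hne s (t + 1) (by unfold InHex; omega) (by omega),
      hne (s + 1) t (by unfold InHex; omega) (by omega)]

theorem exists_perm_ppTiling {a b c : ℕ} (π₀ π : PP a b c) (h₀ : π₀.1 = ∅) :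
    ∃ τ : Equiv.Perm (DownTri a b c), Equiv.Perm.sign τ = 1 ∧
      (ppTiling π₀).1 = τ.trans (ppTiling π).1 := by
  obtain ⟨π, hb, hπ⟩ := π
  induction π using Finset.strongInduction with
  | H π ih =>
    rcases π.eq_empty_or_nonempty with rfl | hne
    · refine ⟨1, map_one _, ?_⟩
      rw [show π₀ = ⟨∅, hb, hπ⟩ from Subtype.ext h₀]
      rfl
    -- Erasing a maximal cube leaves an order ideal, and only the height at the projection of its
    -- corner can change.
    · obtain ⟨⟨i, j, k⟩, hmax⟩ := π.exists_maximal hne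
      have hm : (i, j, k) ∈ π := hmax.1
      have hb' : π.erase (i, j, k) ⊆ box a b c := (Finset.erase_subset _ _).trans hb
      have hπ' : IsPlanePartition (π.erase (i, j, k)) := by
        intro v w hwv hv
        simp only [Finset.coe_erase, Set.mem_sdiff, Finset.mem_coe, Set.mem_singleton_iff]
          at hv ⊢
        refine ⟨hπ hwv hv.1, ?_⟩
        rintro rfl
        exact hv.2 (le_antisymm (hmax.2 hv.1 hwv) hwv)
      obtain ⟨τ, hτ, e⟩ := ih _ (Finset.erase_ssubset hm) hb' hπ'
      obtain ⟨F, hF⟩ := exists_hasHeight (a := a) (b := b) (c := c) hπ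
      obtain ⟨F', hF'⟩ := exists_hasHeight (a := a) (b := b) (c := c) hπ'
      have hbox := mem_box.1 (hb hm)
      have hp : InHex a b c (c + j - k) (b + i - j) := by
        unfold InHex
        omega
      have hle : F' (c + j - k) (b + i - j) ≤ j := by
        have := hF'.mem_iff i j k hbox.1 hbox.2.1 hbox.2.2
        simp only [Finset.mem_erase, ne_eq, not_true_eq_false, false_and, false_iff] at this
        omega
      have hlt := (hF.mem_iff i j k hbox.1 hbox.2.1 hbox.2.2).1 hm
      obtain ⟨σ, hσ, e'⟩ := hF.isHeight.exists_perm_of_flip hF'.isHeight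
        (x := c + j - k) (y := b + i - j) (fun s t hst hne => le_antisymm
          (hF'.le_of_imp hF hst fun _ _ _ _ _ h => Finset.mem_of_mem_erase h)
          (hF.le_of_imp hF' hst fun i' j' k' h1 h2 h => Finset.mem_erase.2 ⟨by
            simp only [ne_eq, Prod.mk.injEq]
            omega, h⟩)) (by omega) (by unfold InHex; omega) (by unfold InHex; omega)
        (by unfold InHex; omega) (by unfold InHex; omega) (by unfold InHex; omega)
        (by unfold InHex; omega)
      refine ⟨σ * τ, by rw [map_mul, hτ, hσ, one_mul], ?_⟩
      rw [e, HasHeight.ppTiling_eq (π := ⟨_, hb', hπ'⟩) hF', e',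
        HasHeight.ppTiling_eq (π := ⟨_, hb, hπ⟩) hF]
      rfl

theorem sign_tiling_eq {a b c : ℕ} (e : DownTri a b c ≃ UpTri a b c) (g g' : Tiling a b c) :
    Equiv.Perm.sign (g.1.trans e.symm) = Equiv.Perm.sign (g'.1.trans e.symm) := by
  have hempty : IsPlanePartition ∅ := by simp [IsPlanePartition, isLowerSet_empty]
  let π₀ : PP a b c := ⟨∅, Finset.empty_subset _, hempty⟩
  have key : ∀ g : Tiling a b c, Equiv.Perm.sign ((ppTiling π₀).1.trans e.symm) =
      Equiv.Perm.sign (g.1.trans e.symm) := by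
    intro g
    obtain ⟨π, rfl⟩ := (ppTiling_bijective a b c).2 g
    obtain ⟨τ, hτ, h⟩ := exists_perm_ppTiling π₀ π rfl
    rw [h, Equiv.trans_assoc]
    change Equiv.Perm.sign (((ppTiling π).1.trans e.symm : Equiv.Perm (DownTri a b c)) * τ) = _
    rw [map_mul, hτ, mul_one]
  rw [← key g, ← key g']

/-- This also gives the equality of the two colour classes, without counting triangles. -/
theorem nonempty_tiling (a b c : ℕ) : Nonempty (Tiling a b c) :=
  (Nat.card_pos_iff.1 ((N1_pos a b c).trans_eq (card_tiling a b c).symm)).1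

/-! ### Determinant and permanent. -/

/-- Tilings as permutations of the `∇` triangles, through a bijection of the two kinds. -/
def tilingPermEquiv {a b c : ℕ} (e : DownTri a b c ≃ UpTri a b c) :
    {σ : Equiv.Perm (DownTri a b c) // ∀ i, TriAdj (σ i).1 (e i).1} ≃ Tiling a b c where
  toFun σ := ⟨σ.1.symm.trans e, fun d => by simpa using σ.2 (σ.1.symm d)⟩
  invFun g := ⟨e.trans g.1.symm, fun i => by simpa using g.2 (g.1.symm (e i))⟩
  left_inv σ := Subtype.ext (Equiv.ext fun i => by simp)
  right_inv g := Subtype.ext (Equiv.ext fun d => by simp)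

open Classical in
theorem prod_M_submatrix {a b c : ℕ} (e : DownTri a b c ≃ UpTri a b c)
    (σ : Equiv.Perm (DownTri a b c)) : ∏ i, ((M a b c).submatrix id e) (σ i) i =
      if ∀ i, TriAdj (σ i).1 (e i).1 then 1 else 0 := by
  simp only [Matrix.submatrix_apply, id, M, Z_adj_inl_inr]
  rw [Finset.prod_ite_zero]
  simp

theorem permanent_M {a b c : ℕ} (e : DownTri a b c ≃ UpTri a b c) :
    ((M a b c).submatrix id e).permanent = (N1 a b c : ℤ) := by
  classical
  rw [Matrix.permanent, Finset.sum_congr rfl fun σ _ => prod_M_submatrix e σ, Finset.sum_boole,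
    ← card_tiling, ← Nat.card_congr (tilingPermEquiv e), Nat.card_eq_fintype_card,
    Fintype.card_subtype]

theorem abs_det_M {a b c : ℕ} (e : DownTri a b c ≃ UpTri a b c) :
    |((M a b c).submatrix id e).det| = ((M a b c).submatrix id e).permanent := by
  classical
  obtain ⟨g₀⟩ := nonempty_tiling a b c
  -- A nonzero term comes from a tiling, and its sign is that of the fixed tiling `g₀`, so this sign
  -- factors out.
  have h : ((M a b c).submatrix id e).det =
      Equiv.Perm.sign (g₀.1.trans e.symm) * ((M a b c).submatrix id e).permanent := by
    rw [Matrix.det_apply, Matrix.permanent, Finset.mul_sum]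
    refine Finset.sum_congr rfl fun σ _ => ?_
    rw [prod_M_submatrix]
    split_ifs with hσ
    · rw [← sign_tiling_eq e (tilingPermEquiv e ⟨σ, hσ⟩) g₀]
      have : ((tilingPermEquiv e ⟨σ, hσ⟩).1.trans e.symm : Equiv.Perm (DownTri a b c)) = σ⁻¹ := by
        ext1 d
        simp [tilingPermEquiv]
      rw [this, Equiv.Perm.sign_inv, Units.smul_def, smul_eq_mul]
    · simp
  have h0 : (0 : ℤ) ≤ ((M a b c).submatrix id e).permanent := by
    rw [permanent_M]
    positivity
  rw [h, abs_mul, abs_of_nonneg h0]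
  rcases Int.units_eq_one_or (Equiv.Perm.sign (g₀.1.trans e.symm)) with hs | hs <;> simp [hs]

/-! ### Tilings as perfect matchings of the graph. -/

/-- The perfect matching of a tiling, as a subgraph. -/
def tilingSubgraph {a b c : ℕ} (g : Tiling a b c) : (Z a b c).Subgraph where
  verts := Set.univ
  Adj s t := (∃ d, s = Sum.inl d ∧ t = Sum.inr (g.1 d)) ∨ ∃ d, t = Sum.inl d ∧ s = Sum.inr (g.1 d)
  adj_sub := by
    rintro s t (⟨d, rfl, rfl⟩ | ⟨d, rfl, rfl⟩)
    · exact (Z_adj_inl_inr _ _).2 (g.2 d)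
    · exact ((Z_adj_inl_inr _ _).2 (g.2 d)).symm
  edge_vert _ := Set.mem_univ _
  symm := ⟨fun _ _ h => h.symm⟩

theorem isPerfectMatching_tilingSubgraph {a b c : ℕ} (g : Tiling a b c) :
    (tilingSubgraph g).IsPerfectMatching := by
  rw [SimpleGraph.Subgraph.isPerfectMatching_iff]
  rintro (d | u)
  · refine ⟨Sum.inr (g.1 d), Or.inl ⟨d, rfl, rfl⟩, ?_⟩
    rintro t (⟨d', h, rfl⟩ | ⟨d', rfl, h⟩)
    · rw [Sum.inl_injective h]
    · cases h
  · refine ⟨Sum.inl (g.1.symm u), Or.inr ⟨_, rfl, by simp⟩, ?_⟩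
    rintro t (⟨d', h, rfl⟩ | ⟨d', rfl, h⟩)
    · cases h
    · rw [Sum.inr_injective h, Equiv.symm_apply_apply]

theorem tilingSubgraph_bijective (a b c : ℕ) : Function.Bijective
    (fun g : Tiling a b c => (⟨tilingSubgraph g, isPerfectMatching_tilingSubgraph g⟩ :
      {S : (Z a b c).Subgraph // S.IsPerfectMatching})) := by
  constructor
  · intro g g' h
    apply Subtype.ext
    ext1 d
    have h1 : (tilingSubgraph g).Adj (Sum.inl d) (Sum.inr (g.1 d)) := Or.inl ⟨d, rfl, rfl⟩
    have h0 : tilingSubgraph g = tilingSubgraph g' := congrArg Subtype.val h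
    rw [h0] at h1
    rcases h1 with ⟨d', h2, h3⟩ | ⟨d', h2, h3⟩
    · rw [Sum.inl_injective h2] at h3 ⊢
      exact Sum.inr_injective h3
    · cases h2
  · rintro ⟨S, hS⟩
    have hS' := SimpleGraph.Subgraph.isPerfectMatching_iff.1 hS
    have hd : ∀ d : DownTri a b c, ∃ u : UpTri a b c, S.Adj (Sum.inl d) (Sum.inr u) := by
      intro d
      obtain ⟨d' | u, h, -⟩ := hS' (Sum.inl d)
      · exact (not_Z_adj_inl_inl _ _ h.adj_sub).elim
      · exact ⟨u, h⟩
    have hu : ∀ u : UpTri a b c, ∃ d : DownTri a b c, S.Adj (Sum.inl d) (Sum.inr u) := by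
      intro u
      obtain ⟨d | u', h, -⟩ := hS' (Sum.inr u)
      · exact ⟨d, h.symm⟩
      · exact (not_Z_adj_inr_inr _ _ h.adj_sub).elim
    choose f hf using hd
    choose f' hf' using hu
    let g : Tiling a b c := ⟨⟨f, f', fun d => Sum.inl_injective
      (hS.1.eq_of_adj_right (hf' (f d)) (hf d)), fun u => Sum.inr_injective
      (hS.1.eq_of_adj_left (hf (f' u)) (hf' u))⟩,
      fun d => (Z_adj_inl_inr _ _).1 (hf d).adj_sub⟩
    have hle : ∀ s t, (tilingSubgraph g).Adj s t → S.Adj s t := by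
      rintro s t (⟨d, rfl, rfl⟩ | ⟨d, rfl, rfl⟩)
      · exact hf d
      · exact (hf d).symm
    -- Containment of the tiling's edges in `S` suffices: each vertex already has its partner there,
    -- and a matching allows no other.
    refine ⟨g, Subtype.ext (SimpleGraph.Subgraph.ext (hS.2.verts_eq_univ).symm ?_)⟩
    funext s t
    refine propext ⟨hle s t, fun h => ?_⟩
    obtain ⟨t', ht', -⟩ :=
      SimpleGraph.Subgraph.isPerfectMatching_iff.1 (isPerfectMatching_tilingSubgraph g) s
    rwa [hS.1.eq_of_adj_left h (hle s t' ht')]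

theorem card_perfectMatchings (a b c : ℕ) :
    Nat.card {S : (Z a b c).Subgraph // S.IsPerfectMatching} = N1 a b c := by
  rw [← card_tiling]
  exact (Nat.card_congr (Equiv.ofBijective _ (tilingSubgraph_bijective a b c))).symm

theorem mainTheorem4 (a b c : ℕ) :
    -- `Z(a,b,c)` is bipartite, the two colours being the `∇` and the `Δ` triangles
    (Z a b c).IsBipartiteWith (Set.range Sum.inl) (Set.range Sum.inr) ∧
    -- there are as many `∇` triangles as `Δ` triangles, so `M(a,b,c)` is square
    Nonempty (DownTri a b c ≃ UpTri a b c) ∧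
    -- for every identification of columns with rows, `|Det M| = Per M = N₁`
    (∀ e : DownTri a b c ≃ UpTri a b c,
      |((M a b c).submatrix id e).det| = ((M a b c).submatrix id e).permanent ∧
      ((M a b c).submatrix id e).permanent = (N1 a b c : ℤ)) ∧
    -- `N₁(a,b,c)` is the number of perfect matchings of `Z(a,b,c)`
    Nat.card {S : (Z a b c).Subgraph // S.IsPerfectMatching} = N1 a b c ∧
    -- the ratio (whose denominator is not zero)
    0 < N1 a b c ∧
    (1 ≤ c → (N1 (a + 1) (b + 1) (c - 1) : ℚ) / (N1 a b c : ℚ) =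
      ((a + b + c).choose (c - 1) : ℚ) / ((a + b).choose a : ℚ)) ∧
    -- MacMahon's formula
    (N1 a b c : ℚ) =
      (H (a + b + c) * H a * H b * H c : ℚ) / (H (a + b) * H (a + c) * H (b + c) : ℚ) := by

  exact ⟨Z_isBipartiteWith a b c, (nonempty_tiling a b c).map Subtype.val,
    fun e => ⟨abs_det_M e, permanent_M e⟩, card_perfectMatchings a b c, N1_pos a b c,
    N1_ratio a b c, N1_eq_div a b c⟩
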